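/- All graphs are finite, connected and undirected, with positive real edge weights; $d_G$ denotes the shortest-path metric and $\log$ is to base 2. A graph with $n$ vertices uses words of $\lfloor\log n\rfloor+1$ bits, and sizes are counted in words. At each vertex the incident edges carry given, pairwise distinct port numbers, each fitting in one word. A routing scheme assigns to each vertex $v$ a routing table $T(v)$ and a label $L(v)$, which are lists of words, for use with a fixed algorithm that does not depend on the graph. A source $u$ with a message for $v$ computes from $T(u)$ and $L(v)$ a header, a list of words, which is attached to the message and is never changed. Every vertex $w$ that the message visits, starting with $u$, decides from $T(w)$ and the header alone whether the message has arrived or through which port it is sent on. The routing from $u$ to $v$ has stretch at most $s$ if the message is delivered at $v$ after travelling a walk of weight at most $s\cdot d_G(u,v)$. There are an algorithm as above, a constant $C$ and a function $\varepsilon:\mathbb N\to\mathbb R$ with $\varepsilon(j)\to0$ as $j\to\infty$ such that the following holds for every graph $G=(V,E)$ with $n$ vertices, all port numbers, every priority ranking $x_1,\dots,x_n$ of $V$ and every integer $t\ge1$. There is a routing scheme for $G$ such that for every $j\in\{1,\dots,n\}$: * the routing table of $x_j$ has size at most $C\,n^{1/t}\log j$; * the label of $x_j$ has size at most $\log j\cdot\lceil\frac{t\log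 j}{\log n}\rceil\cdot(1+\varepsilon(j))$; * the header of a message with destination $x_j$, from any source, has size at most $\log j\cdot(1+\varepsilon(j))$; * routing from any vertex to $x_j$ has stretch at most $4\lceil\frac{t\log j}{\log n}\rceil-3$. For $j=1$, both $\log j$ and $\lceil\frac{t\log j}{\log n}\rceil$ are to be read as $1$ in these bounds. -/

import Mathlib

/-! Compact routing in finite connected undirected graphs with positive real edge weights.

Tables, labels and headers are lists of machine words, and their size is the number of words.
A graph on `n` vertices has words of `⌊log₂ n⌋ + 1` bits. The routing algorithm is fixed once and
for all: it knows nothing about the graph except what the words handed to it say. -/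

namespace PriorityRouting

/-- `a` fits into one machine word of a graph on `n` vertices, i.e. into `⌊log₂ n⌋ + 1` bits. -/
def IsWord (n a : ℕ) : Prop := a < 2 ^ (Nat.log 2 n + 1)

section Graph

variable {V : Type*} (G : SimpleGraph V)

/-- The length of a walk under the edge weights `w`. -/
noncomputable def walkLength {G : SimpleGraph V} (w : Sym2 V → ℝ) {u v : V} (p : G.Walk u v) : ℝ :=
  (p.edges.map w).sum

/-- The shortest path metric `d_G(u, v)`. It is used for connected graphs with positive weights
only, where the infimum is over a non-empty set of non-negative numbers and is attained. -/
noncomputable def graphDist (w : Sym2 V → ℝ) (u v : V) : ℝ :=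
  ⨅ p : G.Walk u v, walkLength w p

/-- A port numbering: at each vertex `u`, the edges `uv` carry pairwise distinct numbers
`port u v`, each of them a word. The numbers are given with the graph, not chosen by the scheme. -/
structure IsPortNumbering (n : ℕ) (port : V → V → ℕ) : Prop where
  isWord : ∀ u v, G.Adj u v → IsWord n (port u v)
  injOn : ∀ u, Set.InjOn (port u) (G.neighborSet u)

end Graph

/-- A routing algorithm. `header T L` is the header which a source with routing table `T` attaches
to a message whose destination has label `L`. `forward T H` is what a vertex with routing table `T`
does with a message with header `H`: `none` says that the message has reached its destination,
`some a` that it is sent over the edge with port number `a`, with the header left as it is. -/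
structure RoutingAlgorithm where
  header : List ℕ → List ℕ → List ℕ
  forward : List ℕ → List ℕ → Option ℕ
  computable_header : Computable₂ header
  computable_forward : Computable₂ forward

/-- The walk `p` is the route of a message with header `H`: each vertex but the last sends the
message to the next one, and the last one keeps it. There is at most one such walk from a given
vertex, since port numbers are distinct. -/
def RoutingAlgorithm.Routes {V : Type*} {G : SimpleGraph V} (A : RoutingAlgorithm)
    (port : V → V → ℕ) (table : V → List ℕ) (H : List ℕ) : {u v : V} → G.Walk u v → Prop
  | u, _, .nil => A.forward (table u) H = none
  | u, _, .cons (v := u') _ p =>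
      A.forward (table u) H = some (port u u') ∧ A.Routes port table H p

/-- `log₂ j`, except that the value is `1` for `j = 1`. -/
noncomputable def lg (j : ℕ) : ℝ := max 1 (Real.logb 2 j)

/-- `⌈t log j / log n⌉`, except that the value is `1` for `j = 1`. -/
noncomputable def levels (n t j : ℕ) : ℕ := max 1 ⌈(t : ℝ) * Real.logb 2 j / Real.logb 2 n⌉₊

end PriorityRouting

/-! The scheme is the hierarchy of clusters of Thorup and Zwick, adapted to the ranking, on top of
a tree routing scheme whose labels are also adapted to the ranking.

**Clusters.** Let `q = n ^ (1 / t)`. Every vertex gets a level below `t`, and `u` is in the cluster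
of `r` if `u` is closer to `r` than to all vertices of higher levels. The vertex `x_j` has
`K = levels n t j` pivots, one for each of the top `K` levels: the nearest vertex of at least that
level. The header leads through the shortest path tree of the first pivot whose cluster contains the
source `u`; clusters are closed under passing to the parent, so the vertices on the route know this
tree. The levels are chosen so that `x_j` has level at least `t - K` (`exists_levels`). Hence the
first pivot is at distance `0` from `x_j`, each further pivot is farther by at most `2 d(u, x_j)`
(`dist_pivot_le`), and the detour through a pivot gives the stretch `4 K - 3`.

**Table sizes.** A vertex stores eight words for each cluster that contains it. If each vertex of
level at least `i` is raised to level `i + 1` with probability `1 / (2 q)`, then the number of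
clusters of level `i` that contain a given vertex is dominated by a geometric random variable
(`subsetMean_pow_le`); only the top `K` levels count for `x_j`, because it has level at least
`t - K` itself. The exponential moments of the sums, weighted by the summable weights `wt j`, form a
potential that can be kept bounded level by level, which yields `O(q log j)` clusters for all `x_j`
at once. This needs `K = O(log j)`, so `t` is first replaced by the minimum of `t` and about `log n`,
which changes `q` by a constant factor only.

**Label sizes.** In each tree the vertices are numbered so that subtrees are intervals
(`RootedTree.exists_numbering`), and a label consists of the number of the vertex and of the ports
of the light edges above it. Heavy children are chosen by total weight, not by size. As the weights
sum up to at most `1`, there are at most `-log₂ (wt j) = (1 + o(1)) log j` light edges above `x_j`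
(`RootedTree.exists_treeRouting`, `tendsto_cost`). -/

namespace PriorityRouting

/-! ### Summable vertex weights -/

/-- The weight of the vertex of rank `j`. It is summable over all ranks, but so barely that its
inverse is `j ^ (1 + o(1))`. -/
noncomputable def wt (j : ℕ) : ℝ := 1 / (((j : ℝ) + 1) * (1 + Real.log ((j : ℝ) + 1)) ^ 2)

/-- The binary logarithm of the inverse weight of the vertex of rank `j`. -/
noncomputable def cost (j : ℕ) : ℝ := -Real.logb 2 (wt j)

lemma log_succ_nonneg (j : ℕ) : 0 ≤ Real.log ((j : ℝ) + 1) :=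
  Real.log_nonneg (by have := Nat.cast_nonneg (α := ℝ) j; linarith)

lemma wt_pos (j : ℕ) : 0 < wt j := by
  have := log_succ_nonneg j
  unfold wt
  positivity

/-- The weights are dominated by the differences of `1 / (1 + log j)`. -/
lemma wt_le_sub {j : ℕ} (hj : 1 ≤ j) :
    wt j ≤ 1 / (1 + Real.log j) - 1 / (1 + Real.log ((j + 1 : ℕ) : ℝ)) := by
  have hj' : (1 : ℝ) ≤ j := by exact_mod_cast hj
  have hb := log_succ_nonneg j
  have ha : 0 ≤ Real.log j := Real.log_nonneg hj'
  have hab : 1 / ((j : ℝ) + 1) ≤ Real.log ((j : ℝ) + 1) - Real.log j := by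
    have h := Real.log_le_sub_one_of_pos (x := (j : ℝ) / (j + 1)) (by positivity)
    rw [Real.log_div (by positivity) (by positivity)] at h
    have : (j : ℝ) / (j + 1) - 1 = -(1 / ((j : ℝ) + 1)) := by field_simp; ring
    linarith
  have hle : Real.log j ≤ Real.log ((j : ℝ) + 1) := by
    have : 0 ≤ 1 / ((j : ℝ) + 1) := by positivity
    linarith
  push_cast
  unfold wt
  set a := Real.log j
  set b := Real.log ((j : ℝ) + 1)
  rw [div_sub_div _ _ (by positivity) (by positivity), ← div_div]
  have : 1 * (1 + b) - (1 + a) * 1 = b - a := by ring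
  rw [this, pow_two]
  gcongr

lemma sum_wt_le_one {V : Type*} [Fintype V] (rank : V ≃ Finset.Icc 1 (Fintype.card V)) :
    ∑ v, wt (rank v) ≤ 1 := by
  have h1 : ∑ v, wt (rank v) = ∑ j ∈ Finset.Icc 1 (Fintype.card V), wt j := by
    rw [Equiv.sum_comp rank (fun j => wt (j : ℕ)), Finset.sum_coe_sort]
  have h2 (n : ℕ) : ∑ j ∈ Finset.Icc 1 n, wt j ≤
      1 / (1 + Real.log ((1 : ℕ) : ℝ)) - 1 / (1 + Real.log ((n + 1 : ℕ) : ℝ)) := by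
    induction n with
    | zero => simp
    | succ n ih =>
      rw [Finset.sum_Icc_succ_top (by omega)]
      have := wt_le_sub (j := n + 1) (by omega)
      linarith
  rw [h1]
  refine (h2 _).trans ?_
  have h3 := log_succ_nonneg (Fintype.card V)
  have h4 : 0 ≤ 1 / (1 + Real.log ((Fintype.card V + 1 : ℕ) : ℝ)) := by push_cast; positivity
  simp only [Nat.cast_one, Real.log_one, add_zero, div_one]
  linarith

lemma cost_eq (j : ℕ) :
    cost j = Real.logb 2 ((j : ℝ) + 1) + 2 * Real.logb 2 (1 + Real.log ((j : ℝ) + 1)) := by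
  have := log_succ_nonneg j
  unfold cost wt
  rw [one_div, Real.logb_inv, neg_neg, Real.logb_mul (by positivity) (by positivity),
    Real.logb_pow]
  norm_num

lemma one_le_lg (j : ℕ) : 1 ≤ lg j := le_max_left _ _

lemma logb_succ_le {j : ℕ} (hj : 1 ≤ j) : Real.logb 2 ((j : ℝ) + 1) ≤ Real.logb 2 j + 1 := by
  have hj' : (1 : ℝ) ≤ j := by exact_mod_cast hj
  have h2 : Real.logb 2 (2 * (j : ℝ)) = Real.logb 2 j + 1 := by
    rw [Real.logb_mul (by norm_num) (by positivity), Real.logb_self_eq_one (by norm_num), add_comm]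
  rw [← h2]
  exact Real.logb_le_logb_of_le (by norm_num) (by positivity) (by linarith)

lemma cost_nonneg (j : ℕ) : 0 ≤ cost j := by
  have := log_succ_nonneg j
  have h0 := Nat.cast_nonneg (α := ℝ) j
  rw [cost_eq]
  have h1 : 0 ≤ Real.logb 2 ((j : ℝ) + 1) := Real.logb_nonneg (by norm_num) (by linarith)
  have h2 : 0 ≤ Real.logb 2 (1 + Real.log ((j : ℝ) + 1)) :=
    Real.logb_nonneg (by norm_num) (by linarith)
  linarith

lemma cost_le {j : ℕ} (hj : 1 ≤ j) : cost j ≤ 6 * lg j := by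
  have hj' : (1 : ℝ) ≤ j := by exact_mod_cast hj
  have h0 := log_succ_nonneg j
  have h1 : Real.logb 2 (1 + Real.log ((j : ℝ) + 1)) ≤ Real.logb 2 ((j : ℝ) + 1) := by
    apply Real.logb_le_logb_of_le (by norm_num) (by positivity)
    have := Real.log_le_sub_one_of_pos (x := (j : ℝ) + 1) (by positivity)
    linarith
  have h2 := logb_succ_le hj
  have h3 : Real.logb 2 j ≤ lg j := le_max_right _ _
  have h4 := one_le_lg j
  rw [cost_eq]
  linarith

open Filter Topology in
/-- The cost of rank `j`, with any constant overhead, is `(1 + o(1)) log j`. -/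
lemma tendsto_cost (c : ℝ) :
    Tendsto (fun j : ℕ => (cost j + c) / lg j - 1) atTop (𝓝 0) := by
  have hL : Tendsto (fun j : ℕ => Real.logb 2 j) atTop atTop :=
    (Real.tendsto_logb_atTop (by norm_num)).comp tendsto_natCast_atTop_atTop
  have hloglog : Tendsto (fun y : ℝ => Real.logb 2 y / y) atTop (𝓝 0) :=
    Real.isLittleO_logb_id_atTop.tendsto_div_nhds_zero
  have hup : Tendsto (fun j : ℕ => (5 + |c|) / Real.logb 2 j +
      2 * (Real.logb 2 (Real.logb 2 j) / Real.logb 2 j)) atTop (𝓝 0) := by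
    simpa using (hL.const_div_atTop (5 + |c|)).add ((hloglog.comp hL).const_mul 2)
  have hlow : Tendsto (fun j : ℕ => -|c| / Real.logb 2 j) atTop (𝓝 0) := hL.const_div_atTop _
  refine tendsto_of_tendsto_of_tendsto_of_le_of_le' hlow hup ?_ ?_
  · filter_upwards [hL.eventually_ge_atTop 1, eventually_ge_atTop 1] with j h1 hj
    have hj' : (1 : ℝ) ≤ j := by exact_mod_cast hj
    have h0 := log_succ_nonneg j
    have hlg : lg j = Real.logb 2 j := max_eq_right h1
    have h2 : Real.logb 2 j ≤ Real.logb 2 ((j : ℝ) + 1) :=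
      Real.logb_le_logb_of_le (by norm_num) (by positivity) (by linarith)
    have h3 : 0 ≤ Real.logb 2 (1 + Real.log ((j : ℝ) + 1)) :=
      Real.logb_nonneg (by norm_num) (by linarith)
    have h4 := neg_abs_le c
    rw [hlg, le_sub_iff_add_le, div_add_one (by positivity), cost_eq]
    rw [div_le_div_iff_of_pos_right (by positivity)]
    linarith
  · filter_upwards [hL.eventually_ge_atTop 1, eventually_ge_atTop 1] with j h1 hj
    have hlg : lg j = Real.logb 2 j := max_eq_right h1
    have h0 := log_succ_nonneg j
    have h2 := logb_succ_le hj
    rw [hlg, cost_eq]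
    set y := Real.logb 2 j
    have hln : Real.log ((j : ℝ) + 1) ≤ Real.logb 2 ((j : ℝ) + 1) := by
      rw [Real.logb, le_div_iff₀ (Real.log_pos (by norm_num))]
      have := Real.log_two_lt_d9
      nlinarith
    have h3 : Real.logb 2 (1 + Real.log ((j : ℝ) + 1)) ≤ 2 + Real.logb 2 y := by
      have h4 : Real.logb 2 (4 * y) = 2 + Real.logb 2 y := by
        rw [Real.logb_mul (by norm_num) (by positivity)]
        congr 1
        rw [show (4 : ℝ) = 2 ^ 2 by norm_num, Real.logb_pow]
        norm_num
      rw [← h4]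
      exact Real.logb_le_logb_of_le (by norm_num) (by positivity) (by linarith)
    have h5 := le_abs_self c
    rw [sub_le_iff_le_add, ← mul_div_assoc, ← add_div, div_add_one (by positivity)]
    rw [div_le_div_iff_of_pos_right (by positivity)]
    linarith

/-! ### Rooted trees -/

/-- A rooted tree on all of `V`, given by parent pointers. The value of `parent` at the root is
irrelevant, and `depth` is any height function that witnesses that all pointers lead to the root. -/
structure RootedTree (V : Type*) where
  root : V
  parent : V → V
  depth : V → ℕ
  depth_lt : ∀ v, v ≠ root → depth (parent v) < depth v

namespace RootedTree

variable {V : Type*} (T : RootedTree V)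

open Classical in
/-- The vertices on the way from the root to `v`, both included. -/
noncomputable def path (v : V) : List V :=
  if _h : v = T.root then [v] else path (T.parent v) ++ [v]
termination_by T.depth v
decreasing_by exact T.depth_lt v _h

lemma path_root : T.path T.root = [T.root] := by rw [path]; simp

lemma path_of_ne {v : V} (h : v ≠ T.root) : T.path v = T.path (T.parent v) ++ [v] := by
  rw [path]; simp [h]

/-- Induction along the parent pointers. -/
lemma induct {P : V → Prop} (root : P T.root)
    (step : ∀ v, v ≠ T.root → P (T.parent v) → P v) (v : V) : P v := by
  induction hd : T.depth v using Nat.strong_induction_on generalizing v with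
  | _ n ih =>
    by_cases h : v = T.root
    · exact h ▸ root
    · exact step v h (ih _ (hd ▸ T.depth_lt v h) _ rfl)

lemma getLast?_path (v : V) : (T.path v).getLast? = some v := by
  by_cases h : v = T.root
  · subst h; simp [path_root]
  · simp [T.path_of_ne h]

lemma path_injective : Function.Injective T.path := fun u v h => by
  have := T.getLast?_path u
  rw [h, T.getLast?_path] at this
  exact (Option.some.inj this).symm

/-- `u` is an ancestor of `v`, or `v` itself. -/
def Anc (u v : V) : Prop := T.path u <+: T.path v

lemma anc_refl (v : V) : T.Anc v v := List.prefix_rfl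

lemma anc_iff {u v : V} (h : v ≠ T.root) : T.Anc u v ↔ u = v ∨ T.Anc u (T.parent v) := by
  unfold Anc
  rw [T.path_of_ne h, List.prefix_concat_iff, ← T.path_of_ne h, T.path_injective.eq_iff]

lemma anc_root_iff {u : V} : T.Anc u T.root ↔ u = T.root := by
  refine ⟨fun h => ?_, fun h => h ▸ T.anc_refl _⟩
  have hne : T.path u ≠ [] := fun h0 => by simpa [h0] using T.getLast?_path u
  rw [Anc, path_root] at h
  obtain ⟨s, hs⟩ := h
  have h1 := T.getLast?_path u
  cases hp : T.path u with
  | nil => exact absurd hp hne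
  | cons a l =>
    rw [hp] at hs h1
    simp only [List.cons_append, List.cons.injEq, List.append_eq_nil_iff] at hs
    rw [hs.2.1] at h1
    simpa [hs.1] using h1.symm

lemma root_anc (v : V) : T.Anc T.root v := by
  induction v using T.induct with
  | root => exact T.anc_refl _
  | step v h ih => exact (T.anc_iff h).2 (Or.inr ih)

lemma anc_parent {v : V} (h : v ≠ T.root) : T.Anc (T.parent v) v :=
  (T.anc_iff h).2 (Or.inr (T.anc_refl _))

lemma Anc.trans {T : RootedTree V} {u v x : V} (h : T.Anc u v) (h' : T.Anc v x) : T.Anc u x :=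
  List.IsPrefix.trans h h'

lemma ne_root_of_not_anc {u v : V} (h : ¬ T.Anc u v) : u ≠ T.root :=
  fun h0 => h (h0 ▸ T.root_anc v)

/-- A proper ancestor of `v` has a child which is an ancestor of `v`. -/
lemma exists_child {u v : V} (h : T.Anc u v) (hne : u ≠ v) :
    ∃ c, c ≠ T.root ∧ T.parent c = u ∧ T.Anc c v := by
  induction v using T.induct with
  | root => exact absurd (T.anc_root_iff.1 h) hne
  | step v hv ih =>
    by_cases hp : u = T.parent v
    · exact ⟨v, hv, hp.symm, T.anc_refl v⟩
    · obtain ⟨c, h1, h2, h3⟩ := ih (((T.anc_iff hv).1 h).resolve_left hne) hp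
      exact ⟨c, h1, h2, h3.trans (T.anc_parent hv)⟩

/-- Distinct children of a vertex have no common descendants. -/
lemma child_unique {c c' v : V} (hc : c ≠ T.root) (hc' : c' ≠ T.root)
    (hp : T.parent c = T.parent c') (h : T.Anc c v) (h' : T.Anc c' v) : c = c' := by
  apply T.path_injective
  have hl : (T.path c).length = (T.path c').length := by
    rw [T.path_of_ne hc, T.path_of_ne hc', hp]; simp
  exact (List.prefix_of_prefix_length_le h h' hl.le).eq_of_length hl

/-! ### Interval numbering -/

/-- In the lexicographic order the lists with a given prefix are convex. -/
lemma prefix_of_not_lt {α : Type*} [LinearOrder α] (P s : List α) :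
    ∀ y : List α, ¬ y < P → ¬ P ++ s < y → P <+: y := by
  induction P with
  | nil => intro y _ _; simp
  | cons a P ih =>
    intro y h1 h2
    cases y with
    | nil => exact absurd (List.nil_lt_cons a P) h1
    | cons b y =>
      rw [List.cons_lt_cons_iff, not_or] at h1
      rw [List.cons_append, List.cons_lt_cons_iff, not_or] at h2
      obtain rfl : a = b := le_antisymm (not_lt.1 h1.1) (not_lt.1 h2.1)
      rw [List.cons_prefix_cons]
      exact ⟨rfl, ih y (fun h => h1.2 ⟨rfl, h⟩) (fun h => h2.2 ⟨rfl, h⟩)⟩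

lemma not_lt_of_prefix {α : Type*} [LinearOrder α] {P y : List α} (h : P <+: y) : ¬ y < P := by
  obtain ⟨s, rfl⟩ := h
  induction P with
  | nil => simp
  | cons a P ih => rw [List.cons_append, List.cons_lt_cons_iff]; simpa using ih

/-- The vertices can be numbered so that the descendants of each vertex form an interval that
starts with the number of the vertex itself. The numbering is by the lexicographic order of the
paths from the root. -/
lemma exists_numbering [Fintype V] : ∃ num last : V → ℕ, Function.Injective num ∧
    (∀ v, num v < Fintype.card V) ∧ (∀ v, last v ≤ Fintype.card V) ∧
    ∀ u v, T.Anc u v ↔ num u ≤ num v ∧ num v < last u := by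
  classical
  let _ : LinearOrder V := LinearOrder.lift' (Fintype.equivFin V) (Fintype.equivFin V).injective
  let below (v : V) : Finset V := {x | T.path x < T.path v}
  let desc (v : V) : Finset V := {x | T.Anc v x}
  have hmem (v x) : x ∈ below v ↔ T.path x < T.path v := by simp [below]
  have hmem' (v x) : x ∈ desc v ↔ T.Anc v x := by simp [desc]
  have hdisj (v) : Disjoint (below v) (desc v) := by
    rw [Finset.disjoint_left]
    intro x hx hx'
    exact not_lt_of_prefix ((hmem' _ _).1 hx') ((hmem _ _).1 hx)
  have hmono {u v} (h : T.path u < T.path v) : (below u).card < (below v).card := by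
    apply Finset.card_lt_card
    rw [Finset.ssubset_iff_of_subset]
    · exact ⟨u, (hmem _ _).2 h, fun h' => lt_irrefl _ ((hmem _ _).1 h')⟩
    · exact fun x hx => (hmem _ _).2 (((hmem _ _).1 hx).trans h)
  have hcard (v) : (below v).card + (desc v).card = (below v ∪ desc v).card :=
    (Finset.card_union_of_disjoint (hdisj v)).symm
  refine ⟨fun v => (below v).card, fun v => (below v).card + (desc v).card, ?_, ?_, ?_, ?_⟩
  · intro u v h
    apply T.path_injective
    rcases lt_trichotomy (T.path u) (T.path v) with h1 | h1 | h1
    · exact absurd h (hmono h1).ne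
    · exact h1
    · exact absurd h (hmono h1).ne'
  · intro v
    have : 0 < (desc v).card := Finset.card_pos.2 ⟨v, (hmem' _ _).2 (T.anc_refl v)⟩
    have := Finset.card_le_univ (below v ∪ desc v)
    have := hcard v
    dsimp only
    omega
  · intro v
    dsimp only
    rw [hcard]
    exact Finset.card_le_univ _
  · intro u v
    dsimp only
    constructor
    · intro h
      constructor
      · apply Finset.card_le_card
        intro x hx
        exact (hmem _ _).2 (((hmem _ _).1 hx).trans_le (not_lt.1 (not_lt_of_prefix h)))
      · rw [hcard]
        apply Finset.card_lt_card
        rw [Finset.ssubset_iff_of_subset]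
        · exact ⟨v, Finset.mem_union_right _ ((hmem' _ _).2 h),
            fun h' => lt_irrefl _ ((hmem _ _).1 h')⟩
        · intro x hx
          by_cases hxu : T.path x < T.path u
          · exact Finset.mem_union_left _ ((hmem _ _).2 hxu)
          · refine Finset.mem_union_right _ ((hmem' _ _).2 ?_)
            obtain ⟨s, hs⟩ := h
            refine prefix_of_not_lt _ s _ hxu ?_
            rw [hs]
            exact not_lt.2 ((hmem _ _).1 hx).le
    · rintro ⟨h1, h2⟩
      by_contra hn
      rcases lt_trichotomy (T.path u) (T.path v) with h3 | h3 | h3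
      · rw [hcard] at h2
        refine absurd (Finset.card_le_card (s := below u ∪ desc u) (t := below v) ?_)
          (not_le.2 h2)
        intro x hx
        rw [hmem]
        rcases Finset.mem_union.1 hx with hx | hx
        · exact ((hmem _ _).1 hx).trans h3
        · by_contra hlt
          obtain ⟨s, hs⟩ := (hmem' _ _).1 hx
          refine hn (prefix_of_not_lt _ s _ (not_lt.2 h3.le) ?_)
          rw [hs]
          exact hlt
      · exact hn (T.path_injective h3 ▸ T.anc_refl v)
      · exact absurd (hmono h3) (not_lt.2 h1)

end RootedTree

/-! ### Routing in a tree -/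

/-- What a vertex does with a message inside a tree. Its row holds, from place `1` on: its number,
the end of the interval of its descendants, the port to its parent, the first number and the end of
the interval of the descendants of its heavy child, the port to the heavy child, and the number of
light edges above it. The destination has number `x` and its light ports are given by `light`. -/
def treeStep (row : ℕ → ℕ) (x : ℕ) (light : ℕ → ℕ) : Option ℕ :=
  if x = row 1 then none
  else if x < row 1 ∨ row 2 ≤ x then some (row 3)
  else if row 4 ≤ x ∧ x < row 5 then some (row 6)
  else some (light (row 7))

lemma isWord_of_le {n a : ℕ} (h : a ≤ n) : IsWord n a :=
  h.trans_lt (Nat.lt_pow_succ_log_self (by norm_num) n)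

lemma isWord_getD {n : ℕ} {l : List ℕ} (h : ∀ a ∈ l, IsWord n a) (k : ℕ) :
    IsWord n (l.getD k 0) := by
  rw [List.getD_eq_getElem?_getD]
  rcases lt_or_ge k l.length with hk | hk
  · rw [List.getElem?_eq_getElem hk]
    exact h _ (List.getElem_mem hk)
  · rw [List.getElem?_eq_none hk]
    exact isWord_of_le (Nat.zero_le _)

namespace RootedTree

variable {V : Type*} (T : RootedTree V)

open Classical in
/-- The ports of the light edges on the way from the root down to `v`, where an edge is light if
it does not lead to the `heavy` child. -/
noncomputable def lights (heavy : V → V) (port : V → V → ℕ) (v : V) : List ℕ :=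
  if _h : v = T.root then []
  else if v = heavy (T.parent v) then lights heavy port (T.parent v)
  else lights heavy port (T.parent v) ++ [port (T.parent v) v]
termination_by T.depth v
decreasing_by all_goals exact T.depth_lt v _h

variable (heavy : V → V) (port : V → V → ℕ)

lemma lights_root : T.lights heavy port T.root = [] := by rw [lights]; simp

lemma lights_heavy {v : V} (h : v ≠ T.root) (hv : v = heavy (T.parent v)) :
    T.lights heavy port v = T.lights heavy port (T.parent v) := by
  rw [lights]; simp [h, ← hv]

lemma lights_light {v : V} (h : v ≠ T.root) (hv : v ≠ heavy (T.parent v)) :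
    T.lights heavy port v = T.lights heavy port (T.parent v) ++ [port (T.parent v) v] := by
  rw [lights]; simp [h, hv]

lemma lights_parent_prefix {v : V} (h : v ≠ T.root) :
    T.lights heavy port (T.parent v) <+: T.lights heavy port v := by
  by_cases hv : v = heavy (T.parent v)
  · rw [T.lights_heavy heavy port h hv]
  · rw [T.lights_light heavy port h hv]
    exact List.prefix_append _ _

lemma lights_prefix {u v : V} (h : T.Anc u v) :
    T.lights heavy port u <+: T.lights heavy port v := by
  induction v using T.induct with
  | root => rw [T.anc_root_iff.1 h]
  | step v hv ih =>
    rcases (T.anc_iff hv).1 h with rfl | h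
    · exact List.prefix_rfl
    · exact (ih h).trans (T.lights_parent_prefix heavy port hv)

lemma length_lights_le_depth (v : V) : (T.lights heavy port v).length ≤ T.depth v := by
  induction v using T.induct with
  | root => simp [lights_root]
  | step v hv ih =>
    have := T.depth_lt v hv
    by_cases h : v = heavy (T.parent v)
    · rw [T.lights_heavy heavy port hv h]; omega
    · rw [T.lights_light heavy port hv h]; simp; omega

open Classical in
/-- The total weight of the descendants of `u`. -/
noncomputable def subtreeWeight [Fintype V] (wgt : V → ℝ) (u : V) : ℝ :=
  ∑ v with T.Anc u v, wgt v

variable [Fintype V] (wgt : V → ℝ)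

lemma le_subtreeWeight (hw : ∀ v, 0 ≤ wgt v) (u : V) : wgt u ≤ T.subtreeWeight wgt u := by
  classical
  exact Finset.single_le_sum (f := wgt) (fun v _ => hw v) (by simp [T.anc_refl])

lemma subtreeWeight_root : T.subtreeWeight wgt T.root = ∑ v, wgt v := by
  simp [subtreeWeight, T.root_anc]

lemma subtreeWeight_parent_le (hw : ∀ v, 0 ≤ wgt v) {c : V} (hc : c ≠ T.root) :
    T.subtreeWeight wgt c ≤ T.subtreeWeight wgt (T.parent c) := by
  classical
  apply Finset.sum_le_sum_of_subset_of_nonneg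
  · intro v hv
    simp only [Finset.mem_filter, Finset.mem_univ, true_and] at hv ⊢
    exact (T.anc_parent hc).trans hv
  · exact fun v _ _ => hw v

lemma subtreeWeight_add_le (hw : ∀ v, 0 ≤ wgt v) {c c' : V} (hc : c ≠ T.root)
    (hc' : c' ≠ T.root) (hp : T.parent c = T.parent c') (hne : c ≠ c') :
    T.subtreeWeight wgt c + T.subtreeWeight wgt c' ≤ T.subtreeWeight wgt (T.parent c) := by
  classical
  rw [subtreeWeight, subtreeWeight, ← Finset.sum_union]
  · apply Finset.sum_le_sum_of_subset_of_nonneg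
    · intro v hv
      simp only [Finset.mem_union, Finset.mem_filter, Finset.mem_univ, true_and] at hv ⊢
      rcases hv with hv | hv
      · exact (T.anc_parent hc).trans hv
      · exact hp ▸ (T.anc_parent hc').trans hv
    · exact fun v _ _ => hw v
  · rw [Finset.disjoint_left]
    intro v hv hv'
    simp only [Finset.mem_filter, Finset.mem_univ, true_and] at hv hv'
    exact hne (T.child_unique hc hc' hp hv hv')

/-- Each vertex can choose a heavy child so that all its other children carry at most half of the
weight of its own subtree. -/
lemma exists_heavy (hw : ∀ v, 0 ≤ wgt v) : ∃ heavy : V → V, ∀ c, c ≠ T.root →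
    c ≠ heavy (T.parent c) → 2 * T.subtreeWeight wgt c ≤ T.subtreeWeight wgt (T.parent c) := by
  classical
  have key (u : V) : ∃ h : V, ∀ c, c ≠ T.root → T.parent c = u → c ≠ h →
      2 * T.subtreeWeight wgt c ≤ T.subtreeWeight wgt u := by
    by_cases hne : (Finset.univ.filter fun c => c ≠ T.root ∧ T.parent c = u).Nonempty
    · obtain ⟨h, hmem, hmax⟩ := Finset.exists_max_image _ (T.subtreeWeight wgt) hne
      simp only [Finset.mem_filter, Finset.mem_univ, true_and] at hmem hmax
      refine ⟨h, fun c hc hp hch => ?_⟩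
      have h1 := hmax c ⟨hc, hp⟩
      have h2 := T.subtreeWeight_add_le wgt hw hc hmem.1 (hp.trans hmem.2.symm) hch
      rw [hp] at h2
      linarith
    · refine ⟨u, fun c hc hp _ => absurd ⟨c, ?_⟩ hne⟩
      simp [hc, hp]
  choose heavy hheavy using key
  exact ⟨heavy, fun c hc hch => hheavy _ c hc rfl hch⟩

/-- Each light edge halves the weight of the subtree. -/
lemma two_pow_lights_mul_le (hw : ∀ v, 0 ≤ wgt v)
    (hheavy : ∀ c, c ≠ T.root → c ≠ heavy (T.parent c) →
      2 * T.subtreeWeight wgt c ≤ T.subtreeWeight wgt (T.parent c)) (v : V) :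
    2 ^ (T.lights heavy port v).length * T.subtreeWeight wgt v ≤ ∑ x, wgt x := by
  induction v using T.induct with
  | root => simp [lights_root, subtreeWeight_root]
  | step v hv ih =>
    refine le_trans ?_ ih
    by_cases h : v = heavy (T.parent v)
    · rw [T.lights_heavy heavy port hv h]
      gcongr
      exact T.subtreeWeight_parent_le wgt hw hv
    · rw [T.lights_light heavy port hv h, List.length_append, List.length_singleton, pow_succ,
        mul_assoc]
      gcongr
      exact hheavy v hv h

/-- Routing in a tree with given ports: the label of `v` consists of its number and of at most
`log₂ (1 / wgt v)` ports, and every vertex has a row of constantly many words, the first of which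
is the given name of the tree. -/
theorem exists_treeRouting {G : SimpleGraph V} {port : V → V → ℕ}
    (hport : IsPortNumbering G (Fintype.card V) port)
    (hadj : ∀ v, v ≠ T.root → G.Adj v (T.parent v)) (hdepth : ∀ v, T.depth v < Fintype.card V)
    (hw : ∀ v, 0 < wgt v) (hsum : ∑ v, wgt v ≤ 1) {name : ℕ} (hname : name ≤ Fintype.card V) :
    ∃ (num : V → ℕ) (row : V → ℕ → ℕ) (lights : V → List ℕ),
      (∀ v, IsWord (Fintype.card V) (num v)) ∧
      (∀ v k, IsWord (Fintype.card V) (row v k)) ∧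
      (∀ v, ∀ a ∈ lights v, IsWord (Fintype.card V) a) ∧
      (∀ v, ((lights v).length : ℝ) ≤ -Real.logb 2 (wgt v)) ∧
      (∀ v, row v 0 = name) ∧
      (∀ v light, treeStep (row v) (num v) light = none) ∧
      (∀ u v light, ¬ T.Anc u v →
        treeStep (row u) (num v) light = some (port u (T.parent u))) ∧
      (∀ u v light, T.Anc u v → u ≠ v → (∀ k, light k = (lights v).getD k 0) →
        ∃ c, c ≠ T.root ∧ T.parent c = u ∧ T.Anc c v ∧
          treeStep (row u) (num v) light = some (port u c)) := by
  classical
  obtain ⟨num, last, hinj, hnum, hlast, hanc⟩ := T.exists_numbering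
  obtain ⟨heavy, hheavy⟩ := T.exists_heavy wgt fun v => (hw v).le
  let isChild (u : V) : Prop := heavy u ≠ T.root ∧ T.parent (heavy u) = u
  let row (u : V) : List ℕ := [name, num u, last u, if u = T.root then 0 else port u (T.parent u),
    if isChild u then num (heavy u) else 0, if isChild u then last (heavy u) else 0,
    if isChild u then port u (heavy u) else 0, (T.lights heavy port u).length]
  have hzero : IsWord (Fintype.card V) 0 := isWord_of_le (Nat.zero_le _)
  have hdown {c : V} (hc : c ≠ T.root) : IsWord (Fintype.card V) (port (T.parent c) c) :=
    hport.isWord _ _ (hadj c hc).symm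
  refine ⟨num, fun u k => (row u).getD k 0, T.lights heavy port, fun v => isWord_of_le (hnum v).le,
    ?_, ?_, ?_, fun v => rfl, ?_, ?_, ?_⟩
  · intro u k
    have hall : ∀ a ∈ row u, IsWord (Fintype.card V) a := by
      simp only [row, List.mem_cons, List.not_mem_nil, or_false, forall_eq_or_imp, forall_eq]
      refine ⟨isWord_of_le hname, isWord_of_le (hnum u).le, isWord_of_le (hlast u), ?_, ?_, ?_, ?_,
        isWord_of_le ((T.length_lights_le_depth heavy port u).trans (hdepth u).le)⟩
      · split_ifs with h
        · exact hzero
        · exact hport.isWord _ _ (hadj u h)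
      · split_ifs
        · exact isWord_of_le (hnum _).le
        · exact hzero
      · split_ifs
        · exact isWord_of_le (hlast _)
        · exact hzero
      · split_ifs with h
        · have := hdown h.1
          rwa [h.2] at this
        · exact hzero
    exact isWord_getD hall k
  · intro v
    induction v using T.induct with
    | root => simp [lights_root]
    | step v hv ih =>
      by_cases h : v = heavy (T.parent v)
      · rwa [T.lights_heavy heavy port hv h]
      · rw [T.lights_light heavy port hv h]
        intro a ha
        rcases List.mem_append.1 ha with ha | ha
        · exact ih a ha
        · rw [List.mem_singleton.1 ha]
          exact hdown hv
  · intro v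
    have h1 := T.two_pow_lights_mul_le heavy port wgt (fun v => (hw v).le) hheavy v
    have h2 : 2 ^ (T.lights heavy port v).length * wgt v ≤ 1 := by
      refine le_trans ?_ (h1.trans hsum)
      gcongr
      exact T.le_subtreeWeight wgt (fun v => (hw v).le) v
    rw [← Real.logb_inv, Real.le_logb_iff_rpow_le (by norm_num) (inv_pos.2 (hw v)),
      Real.rpow_natCast]
    rwa [← one_div, le_div_iff₀ (hw v)]
  · intro v light
    simp [treeStep, row]
  · intro u v light h
    have hne : u ≠ v := fun h0 => h (h0 ▸ T.anc_refl u)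
    have h1 : num v ≠ num u := fun h0 => hne (hinj h0).symm
    have h2 : num v < num u ∨ last u ≤ num v := by
      by_contra hn
      push Not at hn
      exact h ((hanc u v).2 hn)
    simp [treeStep, row, h1, h2, T.ne_root_of_not_anc h]
  · intro u v light h hne hlight
    have h1 : num v ≠ num u := fun h0 => hne (hinj h0).symm
    have h2 : ¬ (num v < num u ∨ last u ≤ num v) := by
      have := (hanc u v).1 h
      omega
    obtain ⟨c, hc, hp, hcv⟩ := T.exists_child h hne
    refine ⟨c, hc, hp, hcv, ?_⟩
    by_cases hch : c = heavy u
    · have h3 : isChild u := ⟨fun h => hc (hch.trans h), hch ▸ hp⟩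
      have h4 := (hanc c v).1 hcv
      rw [hch] at h4
      simp [treeStep, row, h1, h2, h3, h4, hch]
    · have h3 : ¬ (isChild u ∧ T.Anc (heavy u) v) := fun h3 =>
        hch (T.child_unique hc h3.1.1 (hp.trans h3.1.2.symm) hcv h3.2)
      have h4 : ¬ ((if isChild u then num (heavy u) else 0) ≤ num v ∧
          num v < if isChild u then last (heavy u) else 0) := by
        split_ifs with h5
        · rw [← hanc]
          exact fun h6 => h3 ⟨h5, h6⟩
        · omega
      have h5 := T.lights_light heavy port hc (hp ▸ hch)
      have h6 := T.lights_prefix heavy port hcv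
      rw [h5, hp] at h6
      have h7 : (T.lights heavy port v).getD (T.lights heavy port u).length 0 = port u c := by
        obtain ⟨s, hs⟩ := h6
        rw [← hs]
        simp
      simp only [treeStep, row, List.getD_cons_succ, List.getD_cons_zero, h1, h2, h4, if_false,
        hlight, h7]

end RootedTree

/-! ### Random subsets -/

section SubsetMean

variable {V : Type*}

/-- The expectation of `g s`, where `s` is a random subset of `A` that contains each element of `A`
independently with probability `p`. -/
noncomputable def subsetMean (p : ℝ) (A : Finset V) (g : Finset V → ℝ) : ℝ :=
  ∑ s ∈ A.powerset, p ^ s.card * (1 - p) ^ (A.card - s.card) * g s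

variable {p : ℝ}

lemma subsetMean_empty (g : Finset V → ℝ) : subsetMean p ∅ g = g ∅ := by
  simp [subsetMean]

lemma subsetMean_insert [DecidableEq V] {a : V} {A : Finset V} (ha : a ∉ A) (g : Finset V → ℝ) :
    subsetMean p (insert a A) g =
      (1 - p) * subsetMean p A g + p * subsetMean p A (fun s => g (insert a s)) := by
  unfold subsetMean
  rw [Finset.sum_powerset_insert ha, Finset.mul_sum, Finset.mul_sum]
  congr 1
  · refine Finset.sum_congr rfl fun s hs => ?_
    have h1 := Finset.card_le_card (Finset.mem_powerset.1 hs)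
    rw [Finset.card_insert_of_notMem ha, Nat.sub_add_comm h1, pow_succ]
    ring
  · refine Finset.sum_congr rfl fun s hs => ?_
    rw [Finset.card_insert_of_notMem ha,
      Finset.card_insert_of_notMem fun h => ha (Finset.mem_powerset.1 hs h),
      Nat.add_sub_add_right, pow_succ]
    ring

lemma subsetMean_mono (hp0 : 0 ≤ p) (hp1 : p ≤ 1) {A : Finset V} {g h : Finset V → ℝ}
    (hgh : ∀ s ⊆ A, g s ≤ h s) : subsetMean p A g ≤ subsetMean p A h := by
  have := sub_nonneg.2 hp1
  refine Finset.sum_le_sum fun s hs => ?_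
  have := hgh s (Finset.mem_powerset.1 hs)
  gcongr

lemma subsetMean_add (A : Finset V) (g h : Finset V → ℝ) :
    subsetMean p A (fun s => g s + h s) = subsetMean p A g + subsetMean p A h := by
  simp only [subsetMean, mul_add, Finset.sum_add_distrib]

lemma subsetMean_const_mul (A : Finset V) (c : ℝ) (g : Finset V → ℝ) :
    subsetMean p A (fun s => c * g s) = c * subsetMean p A g := by
  simp only [subsetMean, Finset.mul_sum]
  exact Finset.sum_congr rfl fun s _ => by ring

lemma subsetMean_sum {ι : Type*} (I : Finset ι) (A : Finset V) (g : ι → Finset V → ℝ) :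
    subsetMean p A (fun s => ∑ i ∈ I, g i s) = ∑ i ∈ I, subsetMean p A (g i) := by
  simp only [subsetMean, Finset.mul_sum]
  exact Finset.sum_comm

lemma subsetMean_const (A : Finset V) (c : ℝ) : subsetMean p A (fun _ => c) = c := by
  classical
  induction A using Finset.induction_on with
  | empty => exact subsetMean_empty _
  | insert a A ha ih => rw [subsetMean_insert ha, ih]; ring

lemma subsetMean_card (A : Finset V) : subsetMean p A (fun s => (s.card : ℝ)) = p * A.card := by
  classical
  induction A using Finset.induction_on with
  | empty => rw [subsetMean_empty]; simp
  | insert a A ha ih =>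
    rw [subsetMean_insert ha, ih]
    have h : subsetMean p A (fun s => ((insert a s).card : ℝ)) =
        subsetMean p A (fun s => (s.card : ℝ) + 1) := by
      refine Finset.sum_congr rfl fun s hs => ?_
      dsimp only
      rw [Finset.card_insert_of_notMem fun h => ha (Finset.mem_powerset.1 hs h)]
      push_cast
      rfl
    rw [h, subsetMean_add, ih, subsetMean_const, Finset.card_insert_of_notMem ha]
    push_cast
    ring

lemma exists_le_subsetMean (hp0 : 0 < p) (hp1 : p < 1) (A : Finset V) (g : Finset V → ℝ) :
    ∃ s ⊆ A, g s ≤ subsetMean p A g := by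
  by_contra! h
  have h1 : subsetMean p A (fun _ => subsetMean p A g) < subsetMean p A g := by
    apply Finset.sum_lt_sum_of_nonempty ⟨∅, Finset.empty_mem_powerset A⟩
    intro s hs
    have := h s (Finset.mem_powerset.1 hs)
    have := sub_pos.2 hp1
    gcongr
  rw [subsetMean_const] at h1
  exact lt_irrefl _ h1

/-- The number of elements of `A` that come before all elements of a random subset is dominated by
a geometric random variable with success probability `p`; the exponential moment is therefore
bounded. -/
lemma subsetMean_pow_le (hp0 : 0 ≤ p) (hp1 : p ≤ 1) (f : V → ℝ)
    [∀ s : Finset V, DecidablePred fun w => ∀ a ∈ s, f w < f a] (A : Finset V) :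
    subsetMean p A (fun s => (1 + p / 2) ^ (A.filter fun w => ∀ a ∈ s, f w < f a).card) ≤ 2 := by
  classical
  induction A using Finset.induction_on_min_value f with
  | empty => rw [subsetMean_empty]; simp
  | insert a A ha hmin ih =>
    have hq := sub_nonneg.2 hp1
    rw [subsetMean_insert ha]
    have h1 : subsetMean p A (fun s => (1 + p / 2) ^
        ((insert a A).filter fun w => ∀ b ∈ insert a s, f w < f b).card) ≤ 1 := by
      rw [← subsetMean_const (p := p) A 1]
      refine subsetMean_mono hp0 hp1 fun s _ => ?_
      rw [Finset.filter_eq_empty_iff.2]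
      · simp
      · intro w hw hlt
        have h2 := hlt a (Finset.mem_insert_self _ _)
        rcases Finset.mem_insert.1 hw with rfl | hw
        · exact lt_irrefl _ h2
        · exact not_lt.2 (hmin w hw) h2
    have h2 : subsetMean p A (fun s => (1 + p / 2) ^
        ((insert a A).filter fun w => ∀ b ∈ s, f w < f b).card) ≤ (1 + p / 2) * 2 := by
      refine le_trans ?_ (mul_le_mul_of_nonneg_left ih (by positivity))
      rw [← subsetMean_const_mul]
      refine subsetMean_mono hp0 hp1 fun s _ => ?_
      rw [← pow_succ']
      refine pow_le_pow_right₀ (by linarith) ?_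
      rw [Finset.filter_insert]
      split_ifs
      · exact Finset.card_insert_le _ _
      · omega
    nlinarith [mul_le_mul_of_nonneg_left h1 hp0, mul_le_mul_of_nonneg_left h2 hq]

end SubsetMean

/-! ### The hierarchy of levels -/

section Levels

variable {V : Type*} [Fintype V]

open Classical in
/-- The vertices whose level is below `i` and in whose cluster `u` lies: `u` is in the cluster of
`w` if it is closer to `w` than to all vertices of higher levels. -/
noncomputable def bunchBelow (d : V → V → ℝ) (lev : V → ℕ) (i : ℕ) (u : V) : Finset V :=
  {w | lev w < i ∧ ∀ x, lev w < lev x → d u w < d u x}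

variable {d : V → V → ℝ} {K : V → ℕ} {t : ℕ} {q : ℝ} {a : V → ℝ}

/-- A potential argument that derandomizes the choice of the levels. From one level to the next a
vertex survives with probability `1 / (2 q)`, or if its priority forces it to. The first sum
controls the bunches, by an exponential moment, and the second term the number of survivors. A
bunch grows only at the last `K u` levels, hence the exponent of `1 / 2`, which pays for the
constant `2` of `subsetMean_pow_le`. -/
lemma exists_levels_aux (hd0 : ∀ u, d u u = 0) (hd : ∀ u v, 0 ≤ d u v)
    (hK : ∀ v, K v ≤ t) (hq : 1 ≤ q)
    (hcount : ∀ m, 1 ≤ m → ((Finset.univ.filter fun v => K v ≤ m).card : ℝ) ≤ q ^ m)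
    (ha : ∀ v, 0 ≤ a v) (hsum : ∑ v, a v ≤ 1) (i : ℕ) (hi : i + 1 ≤ t) :
    ∃ lev : V → ℕ, (∀ v, lev v ≤ i) ∧ (∀ v, min i (t - K v) ≤ lev v) ∧
      ∑ u, a u * (1 / 2) ^ (K u + i - t) * (1 + 1 / (4 * q)) ^ (bunchBelow d lev i u).card +
        (2 * q) ^ i * (Finset.univ.filter fun v => i ≤ lev v).card / (q ^ t * 2 ^ (t - 1)) ≤
      1 + 2 * (2 ^ i / 2 ^ (t - 1)) := by
  classical
  have hq0 : 0 < q := by linarith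
  induction i with
  | zero =>
    refine ⟨fun _ => 0, by simp, by simp, ?_⟩
    have h1 (u : V) : K u + 0 - t = 0 := by have := hK u; omega
    have h2 : ((Finset.univ.filter fun v => K v ≤ t).card : ℝ) = Fintype.card V := by
      rw [Finset.filter_true_of_mem fun v _ => hK v, Finset.card_univ]
    have h3 := hcount t (by omega)
    rw [h2] at h3
    have h4 : (Fintype.card V : ℝ) / (q ^ t * 2 ^ (t - 1)) ≤ 1 / 2 ^ (t - 1) := by
      rw [← div_div]
      gcongr
      rwa [div_le_one (by positivity)]
    have h5 : (0 : ℝ) ≤ 1 / 2 ^ (t - 1) := by positivity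
    simp only [h1, bunchBelow]
    simp
    rw [← one_div]
    linarith
  | succ i ih =>
    obtain ⟨lev, hle, hmin, hpot⟩ := ih (by omega)
    set A : Finset V := Finset.univ.filter fun v => i ≤ lev v with hA
    set p : ℝ := 1 / (2 * q) with hp
    have hp0 : 0 < p := by positivity
    have hp1 : p ≤ 1 / 2 := by
      rw [hp]
      gcongr
      linarith
    have hz : 1 + 1 / (4 * q) = 1 + p / 2 := by rw [hp]; field_simp; ring
    rw [hz] at hpot ⊢
    set S : Finset V := Finset.univ.filter fun v => K v + (i + 1) ≤ t with hS
    let ω (u : V) : ℝ := a u * (1 / 2) ^ (K u + i - t) * (1 + p / 2) ^ (bunchBelow d lev i u).card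
    have hω (u : V) : 0 ≤ ω u := by have := ha u; positivity
    -- the growth of the bunch of `u`, normalized to expectation at most `1`
    let g (u : V) (s : Finset V) : ℝ := if K u + (i + 1) ≤ t then 1 else
      1 / 2 * (1 + p / 2) ^ (A.filter fun w => ∀ x ∈ s, d u w < d u x).card
    have hg (u : V) : subsetMean p A (g u) ≤ 1 := by
      by_cases h : K u + (i + 1) ≤ t
      · simp only [g, h, if_true]
        exact (subsetMean_const _ _).le
      · simp only [g, h, if_false]
        rw [subsetMean_const_mul]
        have := subsetMean_pow_le hp0.le (by linarith) (d u) A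
        linarith
    set β : ℝ := (2 * q) ^ (i + 1) / (q ^ t * 2 ^ (t - 1)) with hβ
    have hβ0 : 0 ≤ β := by positivity
    obtain ⟨s, hsA, hs⟩ := exists_le_subsetMean hp0 (by linarith) A
      (fun s => ∑ u, ω u * g u s + β * s.card)
    rw [subsetMean_add, subsetMean_sum, subsetMean_const_mul, subsetMean_card] at hs
    have hmean : ∑ u, subsetMean p A (fun s => ω u * g u s) ≤ ∑ u, ω u := by
      refine Finset.sum_le_sum fun u _ => ?_
      rw [subsetMean_const_mul]
      exact mul_le_of_le_one_right (hω u) (hg u)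
    have hβp : β * (p * A.card) = (2 * q) ^ i * A.card / (q ^ t * 2 ^ (t - 1)) := by
      rw [hβ, hp, pow_succ]
      field_simp
    have hSA : S ⊆ A := by
      intro v hv
      simp only [hS, hA, Finset.mem_filter, Finset.mem_univ, true_and] at hv ⊢
      have := hmin v
      omega
    have hsub : s ∪ S ⊆ A := Finset.union_subset hsA hSA
    have hlevA {v : V} (hv : v ∈ s ∪ S) : lev v = i :=
      le_antisymm (hle v) (by simpa [hA] using hsub hv)
    let lev' (v : V) : ℕ := if v ∈ s ∪ S then i + 1 else lev v
    have hlev'1 {v : V} (hv : v ∈ s ∪ S) : lev' v = i + 1 := by simp only [lev', hv, if_true]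
    have hlev'2 {v : V} (hv : v ∉ s ∪ S) : lev' v = lev v := by simp only [lev', hv, if_false]
    have hlev'3 (v : V) : lev v ≤ lev' v := by
      by_cases hv : v ∈ s ∪ S
      · rw [hlev'1 hv, hlevA hv]; omega
      · rw [hlev'2 hv]
    refine ⟨lev', ?_, ?_, ?_⟩
    · intro v
      by_cases hv : v ∈ s ∪ S
      · rw [hlev'1 hv]
      · rw [hlev'2 hv]; have := hle v; omega
    · intro v
      by_cases hv : v ∈ s ∪ S
      · rw [hlev'1 hv]; omega
      · rw [hlev'2 hv]
        have h1 : ¬ K v + (i + 1) ≤ t := fun h =>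
          hv (Finset.mem_union_right _ (by simpa [hS] using h))
        have := hmin v
        omega
    · have hfilter : (Finset.univ.filter fun v => i + 1 ≤ lev' v) = s ∪ S := by
        ext v
        simp only [Finset.mem_filter, Finset.mem_univ, true_and]
        by_cases hv : v ∈ s ∪ S
        · simp [hv, hlev'1 hv]
        · have := hle v
          simp only [hv, iff_false, hlev'2 hv]
          omega
      -- a member of the new bunch that is not in the old one has level exactly `i`
      have hbunch (u : V) : bunchBelow d lev' (i + 1) u ⊆ bunchBelow d lev i u ∪
          A.filter fun w => ∀ x ∈ s ∪ S, d u w < d u x := by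
        intro w hw
        simp only [bunchBelow, Finset.mem_filter, Finset.mem_univ, true_and, Finset.mem_union]
          at hw ⊢
        obtain ⟨h1, h2⟩ := hw
        have hws : w ∉ s ∪ S := fun h => by rw [hlev'1 h] at h1; omega
        rw [hlev'2 hws] at h1 h2
        rcases Nat.lt_succ_iff_lt_or_eq.1 h1 with h1 | h1
        · exact Or.inl ⟨h1, fun x hx => h2 x (hx.trans_le (hlev'3 x))⟩
        · refine Or.inr ⟨by simp [hA, h1], fun x hx => h2 x ?_⟩
          rw [hlev'1 (Finset.mem_union.2 hx), h1]
          omega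
      have hterm (u : V) : a u * (1 / 2) ^ (K u + (i + 1) - t) *
          (1 + p / 2) ^ (bunchBelow d lev' (i + 1) u).card ≤ ω u * g u s := by
        have hau := ha u
        have hone : 1 ≤ 1 + p / 2 := by linarith
        by_cases h : K u + (i + 1) ≤ t
        · have h1 : K u + (i + 1) - t = 0 := by omega
          have h2 : K u + i - t = 0 := by omega
          simp only [g, ω, h, if_true, h1, h2, mul_one]
          gcongr
          refine (hbunch u).trans (Finset.union_subset le_rfl ?_)
          intro w hw
          have h3 := (Finset.mem_filter.1 hw).2 u (Finset.mem_union_right _ (by simpa [hS] using h))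
          rw [hd0] at h3
          exact absurd h3 (not_lt.2 (hd u w))
        · have h1 : K u + (i + 1) - t = K u + i - t + 1 := by omega
          simp only [g, ω, h, if_false, h1]
          have h2 : (bunchBelow d lev' (i + 1) u).card ≤ (bunchBelow d lev i u).card +
              (A.filter fun w => ∀ x ∈ s, d u w < d u x).card := by
            refine (Finset.card_le_card (hbunch u)).trans ((Finset.card_union_le _ _).trans ?_)
            gcongr with w hw
            exact fun x hx => Finset.mem_union_left _ hx
          have h3 := pow_le_pow_right₀ hone h2
          rw [pow_add] at h3
          calc _ ≤ _ := mul_le_mul_of_nonneg_left h3 (by positivity)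
            _ = _ := by rw [pow_succ]; ring
      have hcard : ((s ∪ S).card : ℝ) ≤ s.card + q ^ (t - (i + 1)) := by
        have h1 : ((s ∪ S).card : ℝ) ≤ s.card + S.card := by
          exact_mod_cast Finset.card_union_le _ _
        have h2 := hcount (t - (i + 1)) (by omega)
        have h3 : (Finset.univ.filter fun v => K v ≤ t - (i + 1)) = S := by
          rw [hS]
          refine Finset.filter_congr fun v _ => ?_
          omega
        rw [h3] at h2
        linarith
      have hβq : β * q ^ (t - (i + 1)) = 2 ^ (i + 1) / 2 ^ (t - 1) := by
        have h1 : q ^ t = q ^ (i + 1) * q ^ (t - (i + 1)) := by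
          rw [← pow_add]; congr 1; omega
        rw [hβ, h1, mul_pow]
        field_simp
      have hlam : (2 : ℝ) ^ (i + 1) / 2 ^ (t - 1) = 2 * (2 ^ i / 2 ^ (t - 1)) := by
        rw [pow_succ]; ring
      rw [hfilter, mul_div_right_comm, ← hβ]
      have h1 := Finset.sum_le_sum fun u (_ : u ∈ Finset.univ) => hterm u
      have h2 := mul_le_mul_of_nonneg_left hcard hβ0
      rw [mul_add, hβq] at h2
      rw [hβp] at hs
      simp only [ω] at *
      linarith

/-- Levels below `t` such that the vertex `v` has level at least `t - K v`, and such that every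
vertex lies in few clusters. Apart from the `3 q` possible cluster centers of the top level, the
number of clusters around `u` is controlled through an exponential moment with base
`1 + 1 / (4 q) = 1 + p / 2`, where `p = 1 / (2 q)` is the sampling probability. -/
theorem exists_levels (hd0 : ∀ u, d u u = 0) (hd : ∀ u v, 0 ≤ d u v) (ht : 1 ≤ t)
    (hK1 : ∀ v, 1 ≤ K v) (hK : ∀ v, K v ≤ t) (hq : 1 ≤ q)
    (hcount : ∀ m, 1 ≤ m → ((Finset.univ.filter fun v => K v ≤ m).card : ℝ) ≤ q ^ m)
    (ha : ∀ v, 0 ≤ a v) (hsum : ∑ v, a v ≤ 1) :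
    ∃ lev : V → ℕ, (∀ v, lev v < t) ∧ (∀ v, t ≤ K v + lev v) ∧ ∀ u, ∃ N : ℕ,
      a u * (1 + 1 / (4 * q)) ^ N ≤ 3 * 2 ^ K u ∧ ((bunchBelow d lev t u).card : ℝ) ≤ N + 3 * q := by
  classical
  obtain ⟨lev, h1, h2, h3⟩ := exists_levels_aux hd0 hd hK hq hcount ha hsum (t - 1) (by omega)
  have hq0 : 0 < q := by linarith
  have hdiv : (2 : ℝ) ^ (t - 1) / 2 ^ (t - 1) = 1 := div_self (by positivity)
  have hterm (u : V) : 0 ≤ a u * (1 / 2) ^ (K u + (t - 1) - t) *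
      (1 + 1 / (4 * q)) ^ (bunchBelow d lev (t - 1) u).card := by have := ha u; positivity
  have htop : (2 * q) ^ (t - 1) * ((Finset.univ.filter fun v => t - 1 ≤ lev v).card : ℝ) /
      (q ^ t * 2 ^ (t - 1)) = (Finset.univ.filter fun v => t - 1 ≤ lev v).card / q := by
    have h4 : q ^ t = q ^ (t - 1) * q := by rw [← pow_succ]; congr 1; omega
    rw [h4, mul_pow]
    field_simp
  rw [hdiv, htop] at h3
  have hsize : ((Finset.univ.filter fun v => t - 1 ≤ lev v).card : ℝ) ≤ 3 * q := by
    rw [← div_le_iff₀ hq0]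
    have := Finset.sum_nonneg fun u (_ : u ∈ Finset.univ) => hterm u
    linarith
  refine ⟨lev, fun v => by have := h1 v; omega, fun v => ?_, fun u =>
    ⟨(bunchBelow d lev (t - 1) u).card, ?_, ?_⟩⟩
  · have := h2 v; have := hK1 v; have := hK v
    omega
  · have h4 : a u * (1 / 2) ^ (K u + (t - 1) - t) *
        (1 + 1 / (4 * q)) ^ (bunchBelow d lev (t - 1) u).card ≤ 3 := by
      have := Finset.single_le_sum (fun u _ => hterm u) (Finset.mem_univ u)
      have : 0 ≤ ((Finset.univ.filter fun v => t - 1 ≤ lev v).card : ℝ) / q := by positivity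
      linarith
    have h5 : (1 / 2 : ℝ) ^ K u ≤ (1 / 2) ^ (K u + (t - 1) - t) :=
      pow_le_pow_of_le_one (by norm_num) (by norm_num) (by omega)
    have h6 : a u * (1 / 2) ^ K u * (1 + 1 / (4 * q)) ^ (bunchBelow d lev (t - 1) u).card ≤ 3 := by
      refine le_trans ?_ h4
      have := ha u
      gcongr
    calc _ = a u * (1 / 2) ^ K u * (1 + 1 / (4 * q)) ^ (bunchBelow d lev (t - 1) u).card *
          2 ^ K u := by
          rw [show (1 / 2 : ℝ) ^ K u = 1 / 2 ^ K u by rw [div_pow, one_pow]]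
          field_simp
      _ ≤ _ := by gcongr
  · refine le_trans ?_ (add_le_add_right hsize _)
    have : bunchBelow d lev t u ⊆ bunchBelow d lev (t - 1) u ∪
        Finset.univ.filter fun v => t - 1 ≤ lev v := by
      intro w hw
      simp only [bunchBelow, Finset.mem_filter, Finset.mem_univ, true_and, Finset.mem_union]
        at hw ⊢
      by_cases h : lev w < t - 1
      · exact Or.inl ⟨h, hw.2⟩
      · exact Or.inr (by omega)
    exact_mod_cast (Finset.card_le_card this).trans (Finset.card_union_le _ _)

end Levels

/-! ### The shortest path metric -/

section Metric

variable {V : Type*} {G : SimpleGraph V} {w : Sym2 V → ℝ}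

@[simp] lemma walkLength_nil (u : V) : walkLength w (SimpleGraph.Walk.nil : G.Walk u u) = 0 := rfl

@[simp] lemma walkLength_cons {u v x : V} (h : G.Adj u v) (p : G.Walk v x) :
    walkLength w (.cons h p) = w s(u, v) + walkLength w p := by
  simp [walkLength]

lemma walkLength_append {u v x : V} (p : G.Walk u v) (p' : G.Walk v x) :
    walkLength w (p.append p') = walkLength w p + walkLength w p' := by
  simp [walkLength]

lemma walkLength_reverse {u v : V} (p : G.Walk u v) :
    walkLength w p.reverse = walkLength w p := by
  simp [walkLength, List.sum_reverse]

variable (hw : ∀ e ∈ G.edgeSet, 0 < w e)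

include hw

lemma walkLength_nonneg {u v : V} (p : G.Walk u v) : 0 ≤ walkLength w p := by
  refine List.sum_nonneg fun x hx => ?_
  obtain ⟨e, he, rfl⟩ := List.mem_map.1 hx
  exact (hw e (p.edges_subset_edgeSet he)).le

lemma graphDist_le {u v : V} (p : G.Walk u v) : graphDist G w u v ≤ walkLength w p :=
  ciInf_le ⟨0, by rintro _ ⟨p, rfl⟩; exact walkLength_nonneg hw p⟩ p

lemma graphDist_nonneg (u v : V) : 0 ≤ graphDist G w u v :=
  Real.iInf_nonneg fun p => walkLength_nonneg hw p

lemma graphDist_self (u : V) : graphDist G w u u = 0 :=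
  le_antisymm (graphDist_le hw .nil) (graphDist_nonneg hw u u)

lemma graphDist_le_of_adj {u v : V} (h : G.Adj u v) : graphDist G w u v ≤ w s(u, v) := by
  simpa using graphDist_le hw (SimpleGraph.Walk.cons h .nil)

variable (hG : G.Connected)

include hG

lemma graphDist_comm (u v : V) : graphDist G w u v = graphDist G w v u := by
  have key (u v : V) : graphDist G w u v ≤ graphDist G w v u := by
    have : Nonempty (G.Walk v u) := hG.preconnected v u
    refine le_ciInf fun p => ?_
    rw [← walkLength_reverse]
    exact graphDist_le hw _
  exact le_antisymm (key u v) (key v u)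

lemma graphDist_triangle (u v x : V) :
    graphDist G w u x ≤ graphDist G w u v + graphDist G w v x := by
  have : Nonempty (G.Walk u v) := hG.preconnected u v
  have : Nonempty (G.Walk v x) := hG.preconnected v x
  refine le_ciInf_add_ciInf fun p p' => ?_
  rw [← walkLength_append]
  exact graphDist_le hw _

/-- A vertex has a neighbor that comes next on a shortest path to `v`. -/
lemma exists_next [Finite V] {u v : V} (h : u ≠ v) :
    ∃ x, G.Adj u x ∧ graphDist G w u v = w s(u, x) + graphDist G w x v := by
  have hne : (G.neighborSet u).Nonempty := by
    obtain ⟨p⟩ := hG.preconnected u v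
    cases p with
    | nil => exact absurd rfl h
    | cons h' p => exact ⟨_, h'⟩
  obtain ⟨x, hx, hmin⟩ := Set.exists_min_image (G.neighborSet u)
    (fun x => w s(u, x) + graphDist G w x v) (Set.toFinite _) hne
  refine ⟨x, hx, le_antisymm ?_ ?_⟩
  · have h1 := graphDist_triangle hw hG u x v
    have h2 := graphDist_le_of_adj hw hx
    linarith
  · have : Nonempty (G.Walk u v) := hG.preconnected u v
    refine le_ciInf fun p => ?_
    cases p with
    | nil => exact absurd rfl h
    | cons h' p =>
      rw [walkLength_cons]
      have h1 := hmin _ h'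
      have h2 := graphDist_le hw p
      linarith

/-- The shortest path tree of the vertex `r`, spanned by pointers to the next vertex on a shortest
path. -/
lemma exists_shortestPathTree [Fintype V] (r : V) : ∃ T : RootedTree V, T.root = r ∧
    (∀ v, T.depth v < Fintype.card V) ∧ ∀ v, v ≠ r → G.Adj v (T.parent v) ∧
      graphDist G w v r = w s(v, T.parent v) + graphDist G w (T.parent v) r := by
  classical
  have key (v : V) : ∃ x, v ≠ r → G.Adj v x ∧
      graphDist G w v r = w s(v, x) + graphDist G w x r := by
    by_cases h : v = r
    · exact ⟨v, fun h' => absurd h h'⟩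
    · obtain ⟨x, hx⟩ := exists_next hw hG h
      exact ⟨x, fun _ => hx⟩
  choose parent hparent using key
  refine ⟨⟨r, parent, fun v => (Finset.univ.filter fun x =>
    graphDist G w x r < graphDist G w v r).card, fun v hv => ?_⟩, rfl, fun v => ?_, hparent⟩
  · obtain ⟨h1, h2⟩ := hparent v hv
    have h3 := hw _ ((G.mem_edgeSet).2 h1)
    have h4 : graphDist G w (parent v) r < graphDist G w v r := by linarith
    apply Finset.card_lt_card
    rw [Finset.ssubset_iff_of_subset]
    · exact ⟨parent v, by simpa using h4, by simp⟩
    · intro x hx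
      simp only [Finset.mem_filter, Finset.mem_univ, true_and] at hx ⊢
      exact hx.trans h4
  · apply Finset.card_lt_univ_of_notMem (x := v)
    simp

end Metric

/-! ### The algorithm -/

/-- The number of the row of the table `T` that starts with the word `r`, or the number of rows if
there is none. A table is a matrix with eight columns, stored row by row. -/
def lookup (T : List ℕ) (r : ℕ) : ℕ :=
  (List.range (T.length / 8)).findIdx fun i => T.getD (i * 8) 0 == r

/-- A label starts with a number `K`, followed by a matrix with `K` rows; the header is the first
row whose first word is the name of a tree in the table of the source. -/
def makeHeader (T L : List ℕ) : List ℕ :=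
  let M := (L.length - 1) / L.getD 0 0
  let i := (List.range (L.getD 0 0)).findIdx fun i =>
    decide (lookup T (L.getD (i * M + 1) 0) < T.length / 8)
  (List.range M).map fun m => L.getD (i * M + m + 1) 0

/-- Routing in the tree whose name is the first word of the header. -/
def forwardStep (T H : List ℕ) : Option ℕ :=
  treeStep (fun k => T.getD (lookup T (H.getD 0 0) * 8 + k) 0) (H.getD 1 0)
    fun k => H.getD (2 + k) 0

open Primrec in
lemma primrec_lookup : Primrec₂ lookup := by
  refine list_findIdx (p := fun (a : List ℕ × ℕ) i => a.1.getD (i * 8) 0 == a.2)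
    (list_range.comp (nat_div.comp (list_length.comp fst) (const 8))) ?_
  exact Primrec.beq.comp ((list_getD 0).comp (fst.comp fst) (nat_mul.comp snd (const 8)))
    (snd.comp fst)

open Primrec in
lemma primrec_makeHeader : Primrec₂ makeHeader := by
  have hK : Primrec fun a : List ℕ × List ℕ => a.2.getD 0 0 := (list_getD 0).comp snd (const 0)
  have hM : Primrec fun a : List ℕ × List ℕ => (a.2.length - 1) / a.2.getD 0 0 :=
    nat_div.comp (nat_sub.comp (list_length.comp snd) (const 1)) hK
  have hi : Primrec fun a : List ℕ × List ℕ => (List.range (a.2.getD 0 0)).findIdx fun i =>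
      decide (lookup a.1 (a.2.getD (i * ((a.2.length - 1) / a.2.getD 0 0) + 1) 0) <
        a.1.length / 8) := by
    refine list_findIdx (list_range.comp hK) ?_
    have h : PrimrecPred fun b : (List ℕ × List ℕ) × ℕ =>
        lookup b.1.1 (b.1.2.getD (b.2 * ((b.1.2.length - 1) / b.1.2.getD 0 0) + 1) 0) <
          b.1.1.length / 8 :=
      nat_lt.comp
        (primrec_lookup.comp (fst.comp fst) ((list_getD 0).comp (snd.comp fst)
          (succ.comp (nat_mul.comp snd (hM.comp fst)))))
        (nat_div.comp (list_length.comp (fst.comp fst)) (const 8))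
    exact h.decide
  refine list_map (list_range.comp hM) ?_
  exact (list_getD 0).comp (snd.comp fst)
    (succ.comp (nat_add.comp (nat_mul.comp (hi.comp fst) (hM.comp fst)) snd))

open Primrec in
lemma primrec_forwardStep : Primrec₂ forwardStep := by
  have hrow (k : ℕ) : Primrec fun a : List ℕ × List ℕ =>
      a.1.getD (lookup a.1 (a.2.getD 0 0) * 8 + k) 0 :=
    (list_getD 0).comp fst (nat_add.comp (nat_mul.comp
      (primrec_lookup.comp fst ((list_getD 0).comp snd (const 0))) (const 8)) (const k))
  have hx : Primrec fun a : List ℕ × List ℕ => a.2.getD 1 0 := (list_getD 0).comp snd (const 1)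
  refine ite (Primrec.eq.comp hx (hrow 1)) (const none) ?_
  refine ite (PrimrecPred.or (nat_lt.comp hx (hrow 1)) (nat_le.comp (hrow 2) hx))
    (option_some.comp (hrow 3)) ?_
  refine ite (PrimrecPred.and (nat_le.comp (hrow 4) hx) (nat_lt.comp hx (hrow 5)))
    (option_some.comp (hrow 6)) ?_
  exact option_some.comp ((list_getD 0).comp snd (nat_add.comp (const 2) (hrow 7)))

/-- The routing algorithm. -/
def algorithm : RoutingAlgorithm where
  header := makeHeader
  forward := forwardStep
  computable_header := primrec_makeHeader.to_comp
  computable_forward := primrec_forwardStep.to_comp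

/-- The matrix `f` with `m` rows and `c` columns, stored row by row. -/
def matrixList (c m : ℕ) (f : ℕ → ℕ → ℕ) : List ℕ :=
  (List.range (m * c)).map fun k => f (k / c) (k % c)

lemma length_matrixList (c m : ℕ) (f : ℕ → ℕ → ℕ) : (matrixList c m f).length = m * c := by
  simp [matrixList]

lemma getD_map_range (f : ℕ → ℕ) {n k : ℕ} (h : k < n) :
    ((List.range n).map f).getD k 0 = f k := by
  simp [List.getD_eq_getElem?_getD, h]

lemma getD_matrixList {c m i j : ℕ} (f : ℕ → ℕ → ℕ) (hi : i < m) (hj : j < c) :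
    (matrixList c m f).getD (i * c + j) 0 = f i j := by
  have hlt : i * c + j < m * c := by
    have := Nat.mul_le_mul_right c (Nat.succ_le_of_lt hi)
    rw [Nat.succ_mul] at this
    omega
  rw [matrixList, getD_map_range _ hlt, mul_comm i c, Nat.mul_add_div (by omega),
    Nat.div_eq_of_lt hj, Nat.mul_add_mod, Nat.mod_eq_of_lt hj, add_zero]

lemma isWord_matrixList {n c m : ℕ} {f : ℕ → ℕ → ℕ} (hf : ∀ i j, IsWord n (f i j)) :
    ∀ a ∈ matrixList c m f, IsWord n a := by
  intro a ha
  obtain ⟨k, -, rfl⟩ := List.mem_map.1 ha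
  exact hf _ _

lemma findIdx_range_lt_iff {n : ℕ} {p : ℕ → Bool} :
    (List.range n).findIdx p < n ↔ ∃ i < n, p i = true := by
  have := List.findIdx_lt_length (p := p) (xs := List.range n)
  simpa using this

lemma apply_findIdx_range {n : ℕ} {p : ℕ → Bool} (h : (List.range n).findIdx p < n) :
    p ((List.range n).findIdx p) = true := by
  have := List.findIdx_getElem (p := p) (xs := List.range n) (w := by simpa using h)
  simpa using this

lemma apply_of_lt_findIdx_range {n i : ℕ} {p : ℕ → Bool} (h : i < (List.range n).findIdx p) :
    p i = false := by
  have := List.not_of_lt_findIdx h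
  simpa using this

lemma lookup_lt_iff {m : ℕ} {f : ℕ → ℕ → ℕ} {r : ℕ} :
    lookup (matrixList 8 m f) r < m ↔ ∃ i < m, f i 0 = r := by
  rw [lookup, length_matrixList, Nat.mul_div_cancel _ (by norm_num), findIdx_range_lt_iff]
  refine exists_congr fun i => and_congr_right fun hi => ?_
  rw [← getD_matrixList f hi (c := 8) (j := 0) (by norm_num), beq_iff_eq, add_zero]

lemma apply_lookup {m : ℕ} {f : ℕ → ℕ → ℕ} {r : ℕ} (h : lookup (matrixList 8 m f) r < m) :
    f (lookup (matrixList 8 m f) r) 0 = r := by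
  rw [← getD_matrixList f h (c := 8) (j := 0) (by norm_num), add_zero]
  rw [lookup, length_matrixList, Nat.mul_div_cancel _ (by norm_num)] at h ⊢
  simpa using apply_findIdx_range h

/-- The header is the first row of the label whose tree is known to the source. -/
lemma makeHeader_eq {T : List ℕ} {M K : ℕ} {f : ℕ → ℕ → ℕ} (hM : 1 ≤ M)
    (h : ∃ i < K, lookup T (f i 0) < T.length / 8) :
    ∃ i < K, lookup T (f i 0) < T.length / 8 ∧ (∀ j < i, ¬ lookup T (f j 0) < T.length / 8) ∧
      makeHeader T (K :: matrixList M K f) = (List.range M).map (f i) := by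
  obtain ⟨i₀, hi₀, h₀⟩ := h
  have hlen : ((K :: matrixList M K f).length - 1) / (K :: matrixList M K f).getD 0 0 = M := by
    rw [List.length_cons, length_matrixList, Nat.add_sub_cancel, List.getD_cons_zero,
      Nat.mul_div_cancel_left _ (by omega)]
  have hget {i m : ℕ} (hi : i < K) (hm : m < M) :
      (K :: matrixList M K f).getD (i * M + m + 1) 0 = f i m := by
    rw [List.getD_cons_succ, getD_matrixList f hi hm]
  have hget0 {i : ℕ} (hi : i < K) : (K :: matrixList M K f).getD (i * M + 1) 0 = f i 0 :=
    hget hi (m := 0) hM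
  unfold makeHeader
  rw [hlen, List.getD_cons_zero]
  set p : ℕ → Bool := fun i =>
    decide (lookup T ((K :: matrixList M K f).getD (i * M + 1) 0) < T.length / 8) with hp
  have hpi {i : ℕ} (hi : i < K) : p i = true ↔ lookup T (f i 0) < T.length / 8 := by
    rw [hp]
    dsimp only
    rw [hget0 hi, decide_eq_true_iff]
  have hlt : (List.range K).findIdx p < K := findIdx_range_lt_iff.2 ⟨i₀, hi₀, (hpi hi₀).2 h₀⟩
  refine ⟨(List.range K).findIdx p, hlt, (hpi hlt).1 (apply_findIdx_range hlt), ?_, ?_⟩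
  · intro j hj hj'
    have h1 := apply_of_lt_findIdx_range hj
    rw [(hpi (hj.trans hlt)).2 hj'] at h1
    exact absurd h1 (by simp)
  · refine List.map_congr_left fun m hm => ?_
    exact hget hlt (List.mem_range.1 hm)

lemma isWord_makeHeader {n : ℕ} {T L : List ℕ} (hL : ∀ a ∈ L, IsWord n a) :
    ∀ a ∈ makeHeader T L, IsWord n a := by
  intro a ha
  obtain ⟨m, -, rfl⟩ := List.mem_map.1 ha
  exact isWord_getD hL _

/-! ### Routes in a cluster -/

namespace RootedTree

variable {V : Type*} (T : RootedTree V) {G : SimpleGraph V} {w : Sym2 V → ℝ}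

/-- A set of vertices that is closed under parents contains all ancestors of its members. -/
lemma mem_of_anc {C : V → Prop} (hC : ∀ v, v ≠ T.root → C v → C (T.parent v)) {u v : V}
    (h : T.Anc u v) (hv : C v) : C u := by
  induction v using T.induct with
  | root => rwa [T.anc_root_iff.1 h]
  | step v hr ih =>
    rcases (T.anc_iff hr).1 h with rfl | h
    · exact hv
    · exact ih h (hC v hr hv)

/-- If the vertices of `C` make the right decisions in the tree `T` for the destination `v`, then
the message climbs to the first ancestor of `v` and descends from there. -/
theorem exists_route (A : RoutingAlgorithm) {port : V → V → ℕ} {table : V → List ℕ} {H : List ℕ}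
    {δ : V → ℝ} (hδ : ∀ v, 0 ≤ δ v) (hstep : ∀ v, v ≠ T.root → G.Adj v (T.parent v) ∧
      δ v = w s(v, T.parent v) + δ (T.parent v))
    {C : V → Prop} (hC : ∀ v, v ≠ T.root → C v → C (T.parent v)) {v : V} (hv : C v)
    (harrive : A.forward (table v) H = none)
    (hup : ∀ u, C u → ¬ T.Anc u v → A.forward (table u) H = some (port u (T.parent u)))
    (hdown : ∀ u, C u → T.Anc u v → u ≠ v → ∃ c, c ≠ T.root ∧ T.parent c = u ∧ T.Anc c v ∧
      A.forward (table u) H = some (port u c)) {u : V} (hu : C u) :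
    ∃ p : G.Walk u v, A.Routes port table H p ∧ walkLength w p ≤ δ u + δ v := by
  have descend (n : ℕ) : ∀ u, (T.path v).length - (T.path u).length = n → T.Anc u v →
      ∃ p : G.Walk u v, A.Routes port table H p ∧ walkLength w p = δ v - δ u := by
    induction n with
    | zero =>
      intro u hn h
      have huv : u = v := T.path_injective
        (List.IsPrefix.eq_of_length_le h (Nat.sub_eq_zero_iff_le.1 hn))
      subst huv
      exact ⟨.nil, harrive, by simp⟩
    | succ n ih =>
      intro u hn h
      have hne : u ≠ v := by rintro rfl; omega
      obtain ⟨c, hc, rfl, hcv, hf⟩ := hdown u (T.mem_of_anc hC h hv) h hne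
      have hl : (T.path c).length = (T.path (T.parent c)).length + 1 := by
        rw [T.path_of_ne hc]; simp
      obtain ⟨p, hp, hlen⟩ := ih c (by omega) hcv
      obtain ⟨hadj, hd⟩ := hstep c hc
      refine ⟨.cons hadj.symm p, ⟨hf, hp⟩, ?_⟩
      rw [walkLength_cons, hlen, Sym2.eq_swap]
      linarith
  induction u using T.induct with
  | root =>
    obtain ⟨p, hp, hlen⟩ := descend _ T.root rfl (T.root_anc v)
    exact ⟨p, hp, by have := hδ T.root; linarith⟩
  | step u hr ih =>
    by_cases h : T.Anc u v
    · obtain ⟨p, hp, hlen⟩ := descend _ u rfl h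
      exact ⟨p, hp, by have := hδ u; linarith⟩
    · obtain ⟨p, hp, hlen⟩ := ih (hC u hr hu)
      obtain ⟨hadj, hd⟩ := hstep u hr
      refine ⟨.cons hadj p, ⟨hup u hu h, hp⟩, ?_⟩
      rw [walkLength_cons]
      linarith

end RootedTree

/-! ### The number of levels of a vertex -/

lemma one_le_levels (n t j : ℕ) : 1 ≤ levels n t j := le_max_left _ _

lemma logb_natCast_nonneg (j : ℕ) : 0 ≤ Real.logb 2 (j : ℝ) := by
  rcases Nat.eq_zero_or_pos j with rfl | hj
  · simp
  · exact Real.logb_nonneg (by norm_num) (by exact_mod_cast hj)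

lemma levels_one (n t : ℕ) : levels n t 1 = 1 := by simp [levels]

lemma levels_mono {n t t' : ℕ} (h : t ≤ t') (j : ℕ) : levels n t j ≤ levels n t' j := by
  unfold levels
  have h1 := logb_natCast_nonneg j
  have h2 := logb_natCast_nonneg n
  gcongr

lemma levels_le {n t j : ℕ} (ht : 1 ≤ t) (hj : 1 ≤ j) (hjn : j ≤ n) : levels n t j ≤ t := by
  refine max_le ht (Nat.ceil_le.2 ?_)
  have h0 : Real.logb 2 (j : ℝ) ≤ Real.logb 2 n :=
    Real.logb_le_logb_of_le (by norm_num) (by exact_mod_cast hj) (by exact_mod_cast hjn)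
  rw [mul_div_assoc]
  exact mul_le_of_le_one_right (Nat.cast_nonneg t) (div_le_one_of_le₀ h0 (logb_natCast_nonneg n))

/-- The vertices with at most `m` levels are among the first `n ^ (m / t)`. -/
lemma le_pow_levels {n t j : ℕ} (ht : 1 ≤ t) (hj : 1 ≤ j) (hjn : j ≤ n) :
    (j : ℝ) ≤ ((n : ℝ) ^ (1 / (t : ℝ))) ^ levels n t j := by
  have hj' : (1 : ℝ) ≤ j := by exact_mod_cast hj
  have hn' : (1 : ℝ) ≤ n := by exact_mod_cast hj.trans hjn
  have ht' : (1 : ℝ) ≤ t := by exact_mod_cast ht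
  rcases eq_or_lt_of_le (hj.trans hjn) with rfl | hn
  · have : j = 1 := by omega
    subst this
    simp
  have hlog : 0 < Real.logb 2 (n : ℝ) :=
    Real.logb_pos (by norm_num) (by exact_mod_cast hn)
  rw [← Real.logb_le_logb (b := 2) (by norm_num) (by positivity) (by positivity), Real.logb_pow,
    Real.logb_rpow_eq_mul_logb_of_pos (by positivity)]
  have h1 : (t : ℝ) * Real.logb 2 j / Real.logb 2 n ≤ levels n t j :=
    (Nat.le_ceil _).trans (by exact_mod_cast le_max_right _ _)
  rw [div_le_iff₀ hlog] at h1
  have h2 : Real.logb 2 (j : ℝ) ≤ (levels n t j * Real.logb 2 n) / t := by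
    rw [le_div_iff₀ (by positivity)]
    linarith
  refine h2.trans (le_of_eq ?_)
  ring

lemma levels_le_lg {n t j : ℕ} (ht : t ≤ max 1 (Nat.log 2 n)) (hj : 1 ≤ j) (hjn : j ≤ n) :
    (levels n t j : ℝ) ≤ lg j + 1 := by
  have hlg := one_le_lg j
  have h0 := logb_natCast_nonneg j
  unfold levels
  rw [Nat.cast_max, max_le_iff]
  refine ⟨by push_cast; linarith, ?_⟩
  have hle : (t : ℝ) * Real.logb 2 j / Real.logb 2 n ≤ lg j := by
    rcases Nat.lt_or_ge n 2 with hn | hn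
    · have : j = 1 := by omega
      subst this
      simpa using zero_le_one.trans hlg
    · have h1 : 1 ≤ Nat.log 2 n := Nat.log_pos (by norm_num) hn
      rw [max_eq_right h1] at ht
      have hn' : (0 : ℝ) < n := by exact_mod_cast (by omega : 0 < n)
      have h2 : (t : ℝ) ≤ Real.logb 2 n := by
        rw [Real.le_logb_iff_rpow_le (by norm_num) hn', Real.rpow_natCast]
        exact_mod_cast (pow_le_pow_right₀ (by norm_num) ht).trans (Nat.pow_log_le_self 2 (by omega))
      have h3 : (0 : ℝ) < Real.logb 2 n :=
        Real.logb_pos (by norm_num) (by exact_mod_cast hn)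
      rw [div_le_iff₀ h3, mul_comm]
      exact (mul_le_mul_of_nonneg_left h2 h0).trans
        (mul_le_mul_of_nonneg_right (le_max_right _ _) h3.le)
  exact (Nat.ceil_lt_add_one (by have := logb_natCast_nonneg n; positivity)).le.trans (by linarith)

/-- The logarithmic form of an exponential moment bound. -/
lemma moment_bound {q : ℝ} (hq : 1 ≤ q) {j K N : ℕ} (hj : 1 ≤ j) (hK : (K : ℝ) ≤ lg j + 1)
    (h : wt j * (1 + 1 / (4 * q)) ^ N ≤ 3 * 2 ^ K) : (N : ℝ) ≤ 80 * q * lg j := by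
  have hq0 : 0 < q := by linarith
  have hw := wt_pos j
  have hlg := one_le_lg j
  have hz0 : 0 < 1 + 1 / (4 * q) := by positivity
  have h1 := Real.logb_le_logb_of_le (b := 2) (by norm_num) (by positivity) h
  rw [Real.logb_mul hw.ne' (by positivity), Real.logb_pow,
    Real.logb_mul (by norm_num) (by positivity), Real.logb_pow,
    Real.logb_self_eq_one (by norm_num)] at h1
  have h2 : Real.logb 2 3 ≤ 2 := by
    have : Real.logb 2 3 ≤ Real.logb 2 (2 ^ 2) :=
      Real.logb_le_logb_of_le (by norm_num) (by norm_num) (by norm_num)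
    rw [Real.logb_pow, Real.logb_self_eq_one (by norm_num)] at this
    norm_num at this
    exact this
  have h3 := cost_le hj
  unfold cost at h3
  have h4 : 1 / (8 * q) ≤ Real.logb 2 (1 + 1 / (4 * q)) := by
    have h5 := Real.one_sub_inv_le_log_of_pos hz0
    have h6 : 1 / (8 * q) ≤ 1 - (1 + 1 / (4 * q))⁻¹ := by
      rw [show 1 - (1 + 1 / (4 * q))⁻¹ = 1 / (4 * q + 1) by field_simp; ring]
      gcongr
      linarith
    have h7 : 0 ≤ Real.log (1 + 1 / (4 * q)) := le_trans (by positivity) (h6.trans h5)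
    refine (h6.trans h5).trans ?_
    rw [Real.logb, le_div_iff₀ (Real.log_pos (by norm_num))]
    have := Real.log_two_lt_d9
    nlinarith
  have h8 : (N : ℝ) * (1 / (8 * q)) ≤ 10 * lg j := by
    have := mul_le_mul_of_nonneg_left h4 (Nat.cast_nonneg (α := ℝ) N)
    linarith
  rw [mul_one_div, div_le_iff₀ (by positivity)] at h8
  linarith

/-! ### Pivots -/

section Pivots

variable {V : Type*} {d : V → V → ℝ} {lev : V → ℕ}

/-- Among the vertices of level at least `i` that are closest to `v`, a pivot has the highest
level. Therefore `v` lies in its cluster. -/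
lemma exists_pivot [Finite V] {i : ℕ} (hi : ∃ x, i ≤ lev x) (v : V) : ∃ p, i ≤ lev p ∧
    (∀ x, i ≤ lev x → d v p ≤ d v x) ∧ ∀ x, lev p < lev x → d v p < d v x := by
  obtain ⟨x₀, hx₀⟩ := hi
  obtain ⟨p₀, hp₀, hmin⟩ := Set.exists_min_image {x | i ≤ lev x} (d v) (Set.toFinite _) ⟨x₀, hx₀⟩
  obtain ⟨p, ⟨hp, hpd⟩, hmax⟩ := Set.exists_max_image {x | i ≤ lev x ∧ d v x = d v p₀} lev
    (Set.toFinite _) ⟨p₀, hp₀, rfl⟩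
  refine ⟨p, hp, fun x hx => hpd ▸ hmin x hx, fun x hx => ?_⟩
  have hix : i ≤ lev x := hp.trans hx.le
  refine lt_of_le_of_ne (hpd ▸ hmin x hix) fun h => ?_
  exact absurd (hmax x ⟨hix, h ▸ hpd⟩) (not_le.2 hx)

/-- Each pivot whose cluster misses `u` adds at most `2 d(u, v)` to the distance of the next pivot
of `v`. -/
lemma dist_pivot_le (hcomm : ∀ x y, d x y = d y x) (htri : ∀ x y z, d x z ≤ d x y + d y z)
    (hself : ∀ x, d x x = 0) {u v : V} {k : ℕ} (hv : k ≤ lev v) {piv : ℕ → V} {m : ℕ}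
    (hlev : ∀ i < m, k + i ≤ lev (piv i))
    (hmin : ∀ i < m, ∀ x, k + i ≤ lev x → d v (piv i) ≤ d v x) {i : ℕ} (hi : i < m)
    (hmiss : ∀ j < i, ∃ x, lev (piv j) < lev x ∧ d u x ≤ d u (piv j)) :
    d v (piv i) ≤ 2 * i * d u v := by
  induction i with
  | zero =>
    have := hmin 0 hi v (by omega)
    rw [hself] at this
    simpa using this
  | succ i ih =>
    have h1 := ih (by omega) fun j hj => hmiss j (by omega)
    obtain ⟨x, hx, hux⟩ := hmiss i (by omega)
    have h2 := hlev i (by omega)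
    have h3 := hmin (i + 1) hi x (by omega)
    have h4 := htri v u x
    have h5 := htri u v (piv i)
    have h6 := hcomm u v
    push_cast
    linarith

end Pivots

/-! ### The routing scheme -/

lemma treeStep_congr {r r' : ℕ → ℕ} (h : ∀ k < 8, r k = r' k) (x : ℕ) (light : ℕ → ℕ) :
    treeStep r x light = treeStep r' x light := by
  simp [treeStep, h]

lemma card_filter_levels_le {V : Type*} [Fintype V]
    (rank : V ≃ Finset.Icc 1 (Fintype.card V)) {t : ℕ} (ht : 1 ≤ t)
    (hq : 1 ≤ (Fintype.card V : ℝ) ^ (1 / (t : ℝ))) (m : ℕ) :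
    ((Finset.univ.filter fun v => levels (Fintype.card V) t (rank v) ≤ m).card : ℝ) ≤
      ((Fintype.card V : ℝ) ^ (1 / (t : ℝ))) ^ m := by
  set q := (Fintype.card V : ℝ) ^ (1 / (t : ℝ))
  have h : (Finset.univ.filter fun v => levels (Fintype.card V) t (rank v) ≤ m).card ≤
      (Finset.Icc 1 ⌊q ^ m⌋₊).card := by
    refine Finset.card_le_card_of_injOn (fun v => (rank v : ℕ)) ?_ ?_
    · intro v hv
      have hm : levels (Fintype.card V) t (rank v) ≤ m := by simpa using hv
      have hr := Finset.mem_Icc.1 (rank v).2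
      simp only [Finset.coe_Icc, Set.mem_Icc]
      exact ⟨hr.1, Nat.le_floor ((le_pow_levels ht hr.1 hr.2).trans (pow_le_pow_right₀ hq hm))⟩
    · exact fun u _ v _ h => rank.injective (Subtype.ext h)
  rw [Nat.card_Icc, Nat.add_sub_cancel] at h
  exact (Nat.cast_le.2 h).trans (Nat.floor_le (by positivity))

/-- The routing scheme for a number `t` of levels that is at most logarithmic. -/
theorem exists_scheme {V : Type*} [Fintype V] {G : SimpleGraph V} {w : Sym2 V → ℝ}
    {port : V → V → ℕ} (rank : V ≃ Finset.Icc 1 (Fintype.card V)) {t : ℕ} (hG : G.Connected)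
    (hw : ∀ e ∈ G.edgeSet, 0 < w e) (hport : IsPortNumbering G (Fintype.card V) port)
    (ht : 1 ≤ t) (htn : t ≤ max 1 (Nat.log 2 (Fintype.card V))) :
    ∃ table label : V → List ℕ,
      (∀ v, ∀ a ∈ table v, IsWord (Fintype.card V) a) ∧
      (∀ v, ∀ a ∈ label v, IsWord (Fintype.card V) a) ∧
      (∀ v, ((table v).length : ℝ) ≤
        664 * (Fintype.card V : ℝ) ^ (1 / (t : ℝ)) * lg (rank v)) ∧
      (∀ v, ((label v).length : ℝ) ≤
        levels (Fintype.card V) t (rank v) * (cost (rank v) + 3)) ∧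
      (∀ u v, ((algorithm.header (table u) (label v)).length : ℝ) ≤ cost (rank v) + 3) ∧
      (∀ u v, ∃ p : G.Walk u v,
        algorithm.Routes port table (algorithm.header (table u) (label v)) p ∧
        walkLength w p ≤ (4 * (levels (Fintype.card V) t (rank v) : ℝ) - 3) *
          graphDist G w u v) := by
  classical
  have := hG.nonempty
  have hn1 : 1 ≤ Fintype.card V := Fintype.card_pos
  set q : ℝ := (Fintype.card V : ℝ) ^ (1 / (t : ℝ))
  have hq : 1 ≤ q := Real.one_le_rpow (by exact_mod_cast hn1) (by positivity)
  have hr1 (v : V) : 1 ≤ (rank v : ℕ) := (Finset.mem_Icc.1 (rank v).2).1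
  have hrn (v : V) : (rank v : ℕ) ≤ Fintype.card V := (Finset.mem_Icc.1 (rank v).2).2
  have hrinj {u v : V} (h : (rank u : ℕ) = rank v) : u = v := rank.injective (Subtype.ext h)
  set d : V → V → ℝ := graphDist G w
  let K (v : V) : ℕ := levels (Fintype.card V) t (rank v)
  have hK1 (v : V) : 1 ≤ K v := one_le_levels _ _ _
  have hKt (v : V) : K v ≤ t := levels_le ht (hr1 v) (hrn v)
  have hKn : t ≤ Fintype.card V := htn.trans (max_le hn1 (Nat.log_le_self 2 (Fintype.card V)))
  obtain ⟨lev, hlevt, hlevK, hbunch⟩ := exists_levels (d := d) (K := K) (q := q)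
    (a := fun v => wt (rank v)) (graphDist_self hw) (graphDist_nonneg hw) ht hK1 hKt hq
    (fun m _ => card_filter_levels_le rank ht hq m) (fun v => (wt_pos _).le) (sum_wt_le_one rank)
  let bunch (u : V) : Finset V := bunchBelow d lev t u
  have hmem (u r : V) : r ∈ bunch u ↔ ∀ x, lev r < lev x → d u r < d u x := by
    simp [bunch, bunchBelow, hlevt]
  -- the trees
  choose T hroot hdepth hT using fun r => exists_shortestPathTree hw hG r
  choose num row lights hnum hrow hlights hlen hname harrive hup hdown using fun r =>
    (T r).exists_treeRouting (fun v => wt (rank v)) hport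
      (fun v hv => (hT r v (hroot r ▸ hv)).1) (hdepth r) (fun v => wt_pos _) (sum_wt_le_one rank)
      (hrn r)
  -- the pivots
  have htop : ∃ x, t - 1 ≤ lev x := by
    refine ⟨rank.symm ⟨1, Finset.mem_Icc.2 ⟨le_rfl, hn1⟩⟩, ?_⟩
    have h := hlevK (rank.symm ⟨1, Finset.mem_Icc.2 ⟨le_rfl, hn1⟩⟩)
    have h1 : K (rank.symm ⟨1, Finset.mem_Icc.2 ⟨le_rfl, hn1⟩⟩) = 1 := by
      simp only [K, Equiv.apply_symm_apply]
      exact levels_one (Fintype.card V) t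
    omega
  have hpivot (v : V) (i : ℕ) : ∃ p, i < K v → t - K v + i ≤ lev p ∧
      (∀ x, t - K v + i ≤ lev x → d v p ≤ d v x) ∧ p ∈ bunch v := by
    by_cases hi : i < K v
    · have := hKt v
      obtain ⟨x, hx⟩ := htop
      obtain ⟨p, h1, h2, h3⟩ := exists_pivot (d := d) (lev := lev) (i := t - K v + i)
        ⟨x, by omega⟩ v
      exact ⟨p, fun _ => ⟨h1, h2, (hmem v p).2 h3⟩⟩
    · exact ⟨v, fun h => absurd h hi⟩
  choose piv hpiv using hpivot
  -- the tables
  let m (u : V) : ℕ := (bunch u).toList.length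
  -- the default value `u` is never read, as `i` stays below the length of the list
  let tf (u : V) (i k : ℕ) : ℕ := row ((bunch u).toList.getD i u) u k
  let table (u : V) : List ℕ := matrixList 8 (m u) (tf u)
  have hrows (u : V) : (table u).length / 8 = m u := by
    rw [length_matrixList, Nat.mul_div_cancel _ (by norm_num)]
  have hgetD {u : V} {i : ℕ} (hi : i < m u) : (bunch u).toList.getD i u ∈ bunch u := by
    rw [List.getD_eq_getElem _ _ hi]
    exact Finset.mem_toList.1 (List.getElem_mem hi)
  have hlookup (u r : V) : lookup (table u) (rank r) < (table u).length / 8 ↔ r ∈ bunch u := by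
    rw [hrows, lookup_lt_iff]
    constructor
    · rintro ⟨i, hi, h⟩
      rw [show tf u i 0 = rank _ from hname _ _] at h
      rw [← hrinj h]
      exact hgetD hi
    · intro h
      obtain ⟨i, hi, h'⟩ := List.getElem_of_mem (Finset.mem_toList.2 h)
      refine ⟨i, hi, ?_⟩
      simp only [tf]
      rw [hname, List.getD_eq_getElem _ _ hi, h']
  -- inside the tree of `r`, a vertex of its cluster follows the row that it has for this tree
  have hforward {u r : V} (h : r ∈ bunch u) (H : List ℕ) (hH : H.getD 0 0 = rank r) :
      forwardStep (table u) H = treeStep (row r u) (H.getD 1 0) fun k => H.getD (2 + k) 0 := by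
    have h1 := (hlookup u r).2 h
    rw [hrows] at h1
    have h2 : (bunch u).toList.getD (lookup (table u) (rank r)) u = r := by
      have h3 := apply_lookup h1
      rw [show tf u _ 0 = rank _ from hname _ _] at h3
      exact hrinj h3
    rw [forwardStep, hH]
    refine treeStep_congr (fun k hk => ?_) _ _
    rw [getD_matrixList (tf u) h1 hk]
    change row ((bunch u).toList.getD (lookup (table u) (rank r)) u) u k = row r u k
    rw [h2]
  -- the labels
  let M (v : V) : ℕ := 2 + ⌊cost (rank v)⌋₊
  let entry (v : V) (i : ℕ) : List ℕ :=
    rank (piv v i) :: num (piv v i) v :: lights (piv v i) v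
  let lf (v : V) (i k : ℕ) : ℕ := (entry v i).getD k 0
  let label (v : V) : List ℕ := K v :: matrixList (M v) (K v) (lf v)
  have hM (v : V) : (M v : ℝ) ≤ cost (rank v) + 2 := by
    have := Nat.floor_le (cost_nonneg (rank v))
    simp only [M]
    push_cast
    linarith
  have hentry (v : V) (i : ℕ) : (entry v i).length ≤ M v := by
    have := Nat.le_floor (hlen (piv v i) v)
    simp only [entry, List.length_cons, M]
    unfold cost
    omega
  have hlf (v : V) (i k : ℕ) :
      ((List.range (M v)).map (lf v i)).getD k 0 = (entry v i).getD k 0 := by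
    rcases Nat.lt_or_ge k (M v) with hk | hk
    · rw [getD_map_range _ hk]
    · rw [List.getD_eq_default _ _ (by simpa using hk),
        List.getD_eq_default _ _ ((hentry v i).trans hk)]
  have hlabelWord (v : V) : ∀ a ∈ label v, IsWord (Fintype.card V) a := by
    intro a ha
    rcases List.mem_cons.1 ha with rfl | ha
    · exact isWord_of_le ((hKt v).trans hKn)
    · refine isWord_matrixList (fun i k => isWord_getD ?_ k) a ha
      intro b hb
      rcases List.mem_cons.1 hb with rfl | hb
      · exact isWord_of_le (hrn _)
      · rcases List.mem_cons.1 hb with rfl | hb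
        · exact hnum _ _
        · exact hlights _ _ b hb
  -- the source finds a row of the label whose tree it knows, at the latest the last one
  have hheader (u v : V) : ∃ i < K v, piv v i ∈ bunch u ∧ (∀ j < i, piv v j ∉ bunch u) ∧
      makeHeader (table u) (label v) = (List.range (M v)).map (lf v i) := by
    have hlf0 (i : ℕ) : lf v i 0 = rank (piv v i) := rfl
    have h := makeHeader_eq (T := table u) (M := M v) (K := K v) (f := lf v)
      (by simp only [M]; omega) ⟨K v - 1, by have := hK1 v; omega, by
        rw [hlf0, hlookup, hmem]
        intro x hx
        have h1 := (hpiv v (K v - 1) (by have := hK1 v; omega)).1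
        have h2 := hlevt x
        have h3 := hKt v
        have h4 := hK1 v
        omega⟩
    simpa only [hlf0, hlookup] using h
  refine ⟨table, label, fun v => isWord_matrixList fun i k => hrow _ _ _, hlabelWord, ?_, ?_, ?_, ?_⟩
  · intro v
    obtain ⟨N, hN, hcard⟩ := hbunch v
    have h1 := moment_bound hq (hr1 v) (levels_le_lg htn (hr1 v) (hrn v)) hN
    have h2 := one_le_lg (rank v)
    have h3 : 3 * q ≤ 3 * q * lg (rank v) := le_mul_of_one_le_right (by linarith) h2
    have h4 : ((table v).length : ℝ) = (bunch v).card * 8 := by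
      rw [length_matrixList]
      simp [m]
    rw [h4]
    linarith
  · intro v
    have h1 : ((label v).length : ℝ) = K v * M v + 1 := by
      rw [List.length_cons, length_matrixList]
      push_cast
      ring
    have h2 : (1 : ℝ) ≤ K v := by exact_mod_cast hK1 v
    have h3 := mul_le_mul_of_nonneg_left (hM v) (zero_le_one.trans h2)
    rw [h1]
    change (K v : ℝ) * M v + 1 ≤ K v * (cost (rank v) + 3)
    linarith
  · intro u v
    obtain ⟨i, -, -, -, h⟩ := hheader u v
    change ((makeHeader (table u) (label v)).length : ℝ) ≤ _
    rw [h, List.length_map, List.length_range]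
    linarith [hM v]
  · intro u v
    obtain ⟨i, hi, hui, hmiss, h⟩ := hheader u v
    change ∃ p : G.Walk u v, algorithm.Routes port table (makeHeader (table u) (label v)) p ∧ _
    set H := makeHeader (table u) (label v)
    set r := piv v i with hr
    obtain ⟨-, -, hvr⟩ := hpiv v i hi
    have hH (k : ℕ) : H.getD k 0 = (entry v i).getD k 0 := by rw [h, hlf]
    have hfw {x : V} (hx : r ∈ bunch x) : forwardStep (table x) H =
        treeStep (row r x) (num r v) fun k => (lights r v).getD k 0 := by
      rw [hforward hx H (hH 0), hH 1]
      refine congrArg _ (funext fun k => ?_)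
      rw [hH, add_comm]
      rfl
    have hclosed : ∀ x, x ≠ (T r).root → r ∈ bunch x → r ∈ bunch ((T r).parent x) := by
      intro x hx hxr
      obtain ⟨hadj, hdist⟩ := hT r x (hroot r ▸ hx)
      rw [hmem] at hxr ⊢
      intro y hy
      have h1 : d x r < d x y := hxr y hy
      have h2 : d x y ≤ d x ((T r).parent x) + d ((T r).parent x) y := graphDist_triangle hw hG _ _ _
      have h3 : d x ((T r).parent x) ≤ w s(x, (T r).parent x) := graphDist_le_of_adj hw hadj
      have h4 : d x r = w s(x, (T r).parent x) + d ((T r).parent x) r := hdist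
      linarith
    have hdescend : ∀ x, r ∈ bunch x → (T r).Anc x v → x ≠ v → ∃ c, c ≠ (T r).root ∧
        (T r).parent c = x ∧ (T r).Anc c v ∧
        algorithm.forward (table x) H = some (port x c) := by
      intro x hx hanc hne
      obtain ⟨c, h1, h2, h3, h4⟩ := hdown r x v (fun k => (lights r v).getD k 0) hanc hne
        fun _ => rfl
      exact ⟨c, h1, h2, h3, (hfw hx).trans h4⟩
    obtain ⟨p, hp, hplen⟩ := (T r).exists_route algorithm (G := G) (w := w) (port := port)
      (table := table) (H := H) (δ := fun x => d x r) (fun x => graphDist_nonneg hw x r)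
      (fun x hx => hT r x (hroot r ▸ hx)) (C := fun x => r ∈ bunch x) (v := v) (u := u) hclosed hvr
      ((hfw hvr).trans (harrive r v _)) (fun x hx hanc => (hfw hx).trans (hup r x v _ hanc))
      hdescend hui
    refine ⟨p, hp, hplen.trans ?_⟩
    have h1 := dist_pivot_le (d := d) (lev := lev) (u := u) (v := v) (k := t - K v)
      (piv := piv v) (m := K v) (graphDist_comm hw hG) (graphDist_triangle hw hG)
      (graphDist_self hw) (by have := hlevK v; omega) (fun j hj => (hpiv v j hj).1)
      (fun j hj => (hpiv v j hj).2.1) hi (fun j hj => by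
        have := hmiss j hj
        rw [hmem] at this
        push Not at this
        exact this)
    have h2 : d u r ≤ d u v + d v r := graphDist_triangle hw hG u v r
    have h3 : (i : ℝ) + 1 ≤ K v := by exact_mod_cast hi
    have h4 : 0 ≤ d u v := graphDist_nonneg hw u v
    have h5 := mul_le_mul_of_nonneg_right h3 h4
    change d u r + d v r ≤ (4 * (K v : ℝ) - 3) * d u v
    rw [← hr] at h1
    linarith

/-- Reducing the number of levels to a logarithmic one costs only a constant factor in the size of
the tables. -/
lemma rpow_one_div_min_le {n t : ℕ} (hn : 1 ≤ n) :
    (n : ℝ) ^ (1 / ((min t (max 1 (Nat.log 2 n)) : ℕ) : ℝ)) ≤ 4 * (n : ℝ) ^ (1 / (t : ℝ)) := by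
  have hn' : (1 : ℝ) ≤ n := by exact_mod_cast hn
  have hone : 1 ≤ (n : ℝ) ^ (1 / (t : ℝ)) := Real.one_le_rpow hn' (by positivity)
  rcases le_total t (max 1 (Nat.log 2 n)) with h | h
  · rw [min_eq_left h]
    linarith
  · rw [min_eq_right h]
    refine le_trans ?_ (by linarith : (4 : ℝ) ≤ _)
    set L := max 1 (Nat.log 2 n)
    have hL : 1 ≤ L := le_max_left _ _
    have h1 : n ≤ 4 ^ L := by
      calc n ≤ 2 ^ (Nat.log 2 n + 1) := (Nat.lt_pow_succ_log_self (by norm_num) n).le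
        _ ≤ 2 ^ (2 * L) := Nat.pow_le_pow_right (by norm_num) (by omega)
        _ = 4 ^ L := by rw [pow_mul]; norm_num
    have h2 : (n : ℝ) ≤ 4 ^ L := by exact_mod_cast h1
    calc (n : ℝ) ^ (1 / (L : ℝ)) ≤ ((4 : ℝ) ^ L) ^ (1 / (L : ℝ)) :=
          Real.rpow_le_rpow (by positivity) h2 (by positivity)
      _ = 4 := by rw [one_div, Real.pow_rpow_inv_natCast (by norm_num) (by omega)]

end PriorityRouting

/-- `rank v = j` means that `v` is the vertex `x_j` of the priority ranking. -/
theorem theorem13 :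
    ∃ (A : PriorityRouting.RoutingAlgorithm) (C : ℝ) (ε : ℕ → ℝ),
      Filter.Tendsto ε Filter.atTop (nhds 0) ∧
      ∀ (V : Type*) [Fintype V] (G : SimpleGraph V) (w : Sym2 V → ℝ) (port : V → V → ℕ)
        (rank : V ≃ Finset.Icc 1 (Fintype.card V)) (t : ℕ),
        G.Connected → (∀ e ∈ G.edgeSet, 0 < w e) →
        PriorityRouting.IsPortNumbering G (Fintype.card V) port → 1 ≤ t →
        ∃ table label : V → List ℕ,
          (∀ v, ∀ a ∈ table v, PriorityRouting.IsWord (Fintype.card V) a) ∧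
          (∀ v, ∀ a ∈ label v, PriorityRouting.IsWord (Fintype.card V) a) ∧
          (∀ u v, ∀ a ∈ A.header (table u) (label v),
            PriorityRouting.IsWord (Fintype.card V) a) ∧
          (∀ v, ((table v).length : ℝ) ≤
            C * (Fintype.card V : ℝ) ^ (1 / (t : ℝ)) * PriorityRouting.lg (rank v)) ∧
          (∀ v, ((label v).length : ℝ) ≤
            PriorityRouting.lg (rank v) *
              PriorityRouting.levels (Fintype.card V) t (rank v) * (1 + ε (rank v))) ∧
          (∀ u v, ((A.header (table u) (label v)).length : ℝ) ≤
            PriorityRouting.lg (rank v) * (1 + ε (rank v))) ∧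
          (∀ u v, ∃ p : G.Walk u v,
            A.Routes port table (A.header (table u) (label v)) p ∧
            PriorityRouting.walkLength w p ≤
              (4 * (PriorityRouting.levels (Fintype.card V) t (rank v) : ℝ) - 3) *
                PriorityRouting.graphDist G w u v) := by
  refine ⟨PriorityRouting.algorithm, 4 * 664,
    fun j => (PriorityRouting.cost j + 3) / PriorityRouting.lg j - 1,
    PriorityRouting.tendsto_cost 3, ?_⟩
  intro V _ G w port rank t hG hw hport ht
  have := hG.nonempty
  have hcost (j : ℕ) : PriorityRouting.lg j *
      (1 + ((PriorityRouting.cost j + 3) / PriorityRouting.lg j - 1)) =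
        PriorityRouting.cost j + 3 := by
    have := PriorityRouting.one_le_lg j
    field_simp
    ring
  have hlevels (j : ℕ) : PriorityRouting.levels (Fintype.card V)
      (min t (max 1 (Nat.log 2 (Fintype.card V)))) j ≤
        PriorityRouting.levels (Fintype.card V) t j :=
    PriorityRouting.levels_mono (min_le_left _ _) j
  obtain ⟨table, label, h1, h2, h3, h4, h5, h6⟩ := PriorityRouting.exists_scheme (w := w) rank
    (t := min t (max 1 (Nat.log 2 (Fintype.card V)))) hG hw hport
    (le_min ht (le_max_left _ _)) (min_le_right _ _)
  refine ⟨table, label, h1, h2, fun u v => PriorityRouting.isWord_makeHeader (h2 v), ?_, ?_, ?_, ?_⟩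
  · intro v
    refine (h3 v).trans ?_
    have h7 := PriorityRouting.rpow_one_div_min_le (t := t) (Fintype.card_pos (α := V))
    have h8 := PriorityRouting.one_le_lg (rank v)
    refine mul_le_mul_of_nonneg_right ?_ (by linarith)
    linarith
  · intro v
    refine (h4 v).trans ?_
    have h7 := PriorityRouting.cost_nonneg (rank v)
    have h8 : (_ : ℝ) ≤ _ := Nat.cast_le.2 (hlevels (rank v))
    rw [mul_right_comm, hcost, mul_comm]
    exact mul_le_mul_of_nonneg_left h8 (by linarith)
  · intro u v
    rw [hcost]
    exact h5 u v
  · intro u v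
    obtain ⟨p, hp, hlen⟩ := h6 u v
    refine ⟨p, hp, hlen.trans ?_⟩
    have h8 : (_ : ℝ) ≤ _ := Nat.cast_le.2 (hlevels (rank v))
    refine mul_le_mul_of_nonneg_right ?_ (PriorityRouting.graphDist_nonneg hw u v)
    linarith
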